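/- Let $K$ be a totally real number field of degree $n$ with ring of integers $\mathcal O_K$ and real embeddings $\sigma_1,\dots,\sigma_n:K\to\mathbb R$, and let $L\ge 1$. For real numbers $h_{j,l}$ ($1\le j\le n$, $1\le l\le L$), let $\mathbf H_l=\mathrm{diag}(h_{1,l},\dots,h_{n,l})$ be the block-fading channel from user $l$, over $n$ fading blocks, and let $\mathbf h_j=(h_{j,1},\dots,h_{j,L})^{\top}$. For $P>0$ and $\mathbf a\in\mathcal O_K^L$ put $$F_P(\mathbf a)=\sum_{j=1}^n\sigma_j(\mathbf a)^{\top}\mathbf M_j\,\sigma_j(\mathbf a),\qquad \mathbf M_j=\mathbf I-\frac{P}{P\|\mathbf h_j\|^2+1}\,\mathbf h_j\mathbf h_j^{\top},$$ where $\sigma_j$ is applied componentwise. For $1\le i\le L$ let the $i$-th $\mathcal O_K$-successive minimum be $$\lambda_i(P)=\inf\Big\{r\in\mathbb R:\ \dim_K\mathrm{span}_K\{\mathbf a\in\mathcal O_K^L:\sqrt{F_P(\mathbf a)}\le r\}\ge i\Big\}.$$ Vectors $\mathbf a_1,\dots,\mathbf a_L\in\mathcal O_K^L$ are said to attain the $\mathcal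 O_K$-successive minima if they are linearly independent over $K$ and $\sqrt{F_P(\mathbf a_i)}=\lambda_i(P)$ for every $i$. Such vectors exist for all $\{\mathbf H_l\}$ and all $P>0$. With such vectors chosen for each $P$, define the equation rates $$R_{\mathrm{achv},i}(P)=\frac n2\log_2^{+}\!\Big(\frac{n}{F_P(\mathbf a_i)}\Big),\qquad \log_2^+(x)=\max(\log_2 x,0),$$ and the degrees of freedom (DoF) $$d_{\mathrm{achv},i}=\lim_{P\to\infty}\frac{R_{\mathrm{achv},i}(P)}{\frac12\log_2(1+P)}.$$ The rate $R_{\mathrm{achv},1}$ is called the optimized computation rate and $\sum_{i=1}^L R_{\mathrm{achv},i}$ the optimized computation sum-rate. Theorem. For almost all $\{\mathbf H_l\}_{l=1}^L$ with respect to the Lebesgue measure on $\mathbb R^{nL}$, and for any choice of vectors attaining the $\mathcal O_K$-successive minima at each $P>0$, all the limits $d_{\mathrm{achv},i}$ exist and $$d_{\mathrm{achv},1}=\cdots=d_{\mathrm{achv},L}=\frac nL,\qquad \sum_{i=1}^L d_{\mathrm{achv},i}=n.$$ In particular the DoF of the optimized computation rate is $n/L$. The DoF of the optimized computation sum-rate,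 $\lim_{P\to\infty}\sum_{i=1}^L R_{\mathrm{achv},i}(P)\big/\big(\tfrac12\log_2(1+P)\big)$, exists and equals $n$. -/

import Mathlib

open MeasureTheory Filter Topology NumberField
open scoped Matrix

noncomputable section

namespace RingCF

/-- `log⁺ x = max (log₂ x, 0)`. -/
def logPlus (x : ℝ) : ℝ := max (Real.logb 2 x) 0

/-- The matrix `M = I - P / (P ‖h‖² + 1) • h hᵀ` of one fading block with channel vector `h ∈ ℝ^L`
and power `P`; here `h ⬝ᵥ h` is the squared Euclidean norm of `h`. -/
def blockMatrix {L : ℕ} (P : ℝ) (h : Fin L → ℝ) : Matrix (Fin L) (Fin L) ℝ :=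
  1 - (P / (P * (h ⬝ᵥ h) + 1)) • Matrix.vecMulVec h h

/-- The channel vector `h_j = (h_{j,1}, …, h_{j,L})` of block `j`, where `H l` is the diagonal
`(h_{1,l}, …, h_{n,l})` of the channel matrix of user `l`. -/
def blockVector {n L : ℕ} (H : Fin L → Fin n → ℝ) (j : Fin n) : Fin L → ℝ := fun l => H l j

variable {K : Type*} [Field K] {n L : ℕ}

/-- Componentwise image `σ_j(a) ∈ ℝ^L` of a vector `a ∈ 𝓞_K^L` under a real embedding. -/
def embedVec (s : K →+* ℝ) (a : Fin L → 𝓞 K) : Fin L → ℝ := fun l => s (a l : K)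

/-- The additive Humbert form `F(a) = ∑_j σ_j(a)ᵀ M_j σ_j(a)`. It is the squared length of `a` in
the `𝓞_K`-module `𝓞_K^L` embedded in `ℝ^{nL}` by `a ↦ (M̄_j σ_j(a))_j`, `M_j = M̄_jᵀ M̄_j`. -/
def humbertForm (σ : Fin n → (K →+* ℝ)) (H : Fin L → Fin n → ℝ) (P : ℝ) (a : Fin L → 𝓞 K) : ℝ :=
  ∑ j, embedVec (σ j) a ⬝ᵥ (blockMatrix P (blockVector H j) *ᵥ embedVec (σ j) a)

/-- The `K`-subspace of `K^L` spanned by the module vectors of length at most `r`. -/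
def ballSpan (σ : Fin n → (K →+* ℝ)) (H : Fin L → Fin n → ℝ) (P : ℝ) (r : ℝ) :
    Submodule K (Fin L → K) :=
  Submodule.span K
    {x | ∃ a : Fin L → 𝓞 K, (x = fun l => (a l : K)) ∧ √(humbertForm σ H P a) ≤ r}

/-- The `i`-th `𝓞_K`-successive minimum (`i = 1, …, L`): the infimum of the radii `r` such that the
module vectors of length at most `r` span a `K`-space of dimension at least `i`. -/
def succMin (σ : Fin n → (K →+* ℝ)) (H : Fin L → Fin n → ℝ) (P : ℝ) (i : ℕ) : ℝ :=
  sInf {r : ℝ | i ≤ Module.finrank K (ballSpan σ H P r)}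

/-- `a 0, …, a (L-1)` are coefficient vectors of the `L` `𝓞_K`-successive minima: they are linearly
independent over `K`, and `a i` has length equal to the `(i+1)`-st successive minimum. -/
def AttainsSuccMin (σ : Fin n → (K →+* ℝ)) (H : Fin L → Fin n → ℝ) (P : ℝ)
    (a : Fin L → Fin L → 𝓞 K) : Prop :=
  LinearIndependent K (fun i : Fin L => fun l : Fin L => (a i l : K)) ∧
    ∀ i : Fin L, √(humbertForm σ H P (a i)) = succMin σ H P (i + 1)

/-- The equation rate `(n/2) log⁺ (n / F(a))` of a coefficient vector `a`. -/
def eqRate (σ : Fin n → (K →+* ℝ)) (H : Fin L → Fin n → ℝ) (P : ℝ) (a : Fin L → 𝓞 K) : ℝ :=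
  (n : ℝ) / 2 * logPlus ((n : ℝ) / humbertForm σ H P a)

/-- A rate `R(P)` has `d` degrees of freedom: `R(P) / (½ log₂ (1 + P)) → d` as `P → ∞`. -/
def HasDoF (R : ℝ → ℝ) (d : ℝ) : Prop :=
  Tendsto (fun P : ℝ => R P / (1 / 2 * Real.logb 2 (1 + P))) atTop (𝓝 d)

end RingCF

end

noncomputable section

namespace RingCF

/-! ### The quadratic form of one fading block -/

section BlockForm

variable {L : ℕ}

/-! Write L = m + 1. Both halves of the proof show that every successive minimum of √F is P^(-1/(2L)
+ o(1)) for almost all channels; taking logarithms then gives n/L for each rate.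

Lower bound on the first minimum, metric side. If F(a) < r², every σ_j(a) has norm O(r√P) and is
nearly parallel to h_j: all 2 × 2 minors are O(r). For fixed a this confines h_j to a set of volume
O((r/‖σ_j(a)‖)^m). Sorting the vectors a into dyadic cells by the sizes ‖σ_j(a)‖, whose product is
at least 1, and counting integers in boxes, the exceptional channels have measure at most a power of
log P times (r^L √P)^n (`volume_shortSet_le`). With r = P^(-1/(2L) - δ) and P = 2^M this is
summable, so Borel–Cantelli applies, and monotonicity of F in P fills in the other powers
(`ae_eventually_rpow_le_humbertForm`).

Upper bound on the last minimum, geometry of numbers. If the vectors of length at most r do not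
span, they lie in a hyperplane over K. Minkowski's first theorem, applied to a box of width of order
r across the conjugate hyperplanes and of order μ along them, would produce a vector in that
hyperplane shorter than μ. When μ bounds the first minimum from below, this forces r μ^m √P = O(1)
(`exists_forall_mul_prod_le`). It takes the place of Minkowski's second theorem. -/

lemma dotProduct_blockMatrix_mulVec (P : ℝ) (h y : Fin L → ℝ) :
    y ⬝ᵥ (blockMatrix P h *ᵥ y) = y ⬝ᵥ y - P / (P * (h ⬝ᵥ h) + 1) * (h ⬝ᵥ y) ^ 2 := by
  rw [blockMatrix, Matrix.sub_mulVec, Matrix.one_mulVec, Matrix.smul_mulVec,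
    Matrix.vecMulVec_mulVec, dotProduct_sub, dotProduct_smul]
  simp only [smul_eq_mul, dotProduct_smul, op_smul_eq_smul, dotProduct_comm y h]
  ring

lemma dotProduct_self_nonneg_real (h : Fin L → ℝ) : 0 ≤ h ⬝ᵥ h :=
  Finset.sum_nonneg fun i _ => mul_self_nonneg (h i)

lemma one_le_mul_dotProduct_add_one {P : ℝ} (hP : 0 ≤ P) (h : Fin L → ℝ) :
    1 ≤ P * (h ⬝ᵥ h) + 1 := by
  have := mul_nonneg hP (dotProduct_self_nonneg_real h)
  linarith

lemma dotProduct_sq_le (h y : Fin L → ℝ) : (h ⬝ᵥ y) ^ 2 ≤ (h ⬝ᵥ h) * (y ⬝ᵥ y) := by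
  simpa [dotProduct, sq] using Finset.sum_mul_sq_le_sq_mul_sq Finset.univ h y

/-- Cauchy–Schwarz with the remainder of one `2 × 2` minor. -/
lemma sq_minor_le (h y : Fin L → ℝ) (i k : Fin L) :
    (h i * y k - h k * y i) ^ 2 ≤ (h ⬝ᵥ h) * (y ⬝ᵥ y) - (h ⬝ᵥ y) ^ 2 := by
  rcases eq_or_ne i k with rfl | hik
  · have := dotProduct_sq_le h y
    nlinarith
  · have key : 2 * ((h ⬝ᵥ h) * (y ⬝ᵥ y) - (h ⬝ᵥ y) ^ 2)
        = ∑ p : Fin L × Fin L, (h p.1 * y p.2 - h p.2 * y p.1) ^ 2 := by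
      rw [Fintype.sum_prod_type]
      have : ∀ a b : Fin L, (h a * y b - h b * y a) ^ 2
          = (h a * h a) * (y b * y b) + (y a * y a) * (h b * h b)
            - 2 * ((h a * y a) * (h b * y b)) := fun a b => by ring
      simp only [this, Finset.sum_sub_distrib, Finset.sum_add_distrib, ← Finset.mul_sum,
        ← Finset.sum_mul, dotProduct]
      ring
    have h2 : ∑ p ∈ ({(i, k), (k, i)} : Finset (Fin L × Fin L)),
        (h p.1 * y p.2 - h p.2 * y p.1) ^ 2
        ≤ ∑ p : Fin L × Fin L, (h p.1 * y p.2 - h p.2 * y p.1) ^ 2 :=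
      Finset.sum_le_sum_of_subset_of_nonneg (Finset.subset_univ _) fun _ _ _ => sq_nonneg _
    rw [Finset.sum_pair (by simp [hik])] at h2
    nlinarith

/-- Clearing the denominator isolates the Cauchy–Schwarz defect, weighted by P: a small value of the
form therefore forces near-parallelism as well as boundedness. -/
lemma blockForm_mul_eq {P : ℝ} (hP : 0 ≤ P) (h y : Fin L → ℝ) :
    y ⬝ᵥ (blockMatrix P h *ᵥ y) * (P * (h ⬝ᵥ h) + 1)
      = y ⬝ᵥ y + P * ((h ⬝ᵥ h) * (y ⬝ᵥ y) - (h ⬝ᵥ y) ^ 2) := by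
  have := one_le_mul_dotProduct_add_one hP h
  rw [dotProduct_blockMatrix_mulVec]
  field_simp
  ring

lemma blockForm_ge {P : ℝ} (hP : 0 ≤ P) (h y : Fin L → ℝ) :
    y ⬝ᵥ y / (P * (h ⬝ᵥ h) + 1) ≤ y ⬝ᵥ (blockMatrix P h *ᵥ y) := by
  have h1 := one_le_mul_dotProduct_add_one hP h
  rw [div_le_iff₀ (by linarith), blockForm_mul_eq hP]
  have := mul_nonneg hP (sub_nonneg.2 (dotProduct_sq_le h y))
  linarith

lemma blockForm_nonneg {P : ℝ} (hP : 0 ≤ P) (h y : Fin L → ℝ) :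
    0 ≤ y ⬝ᵥ (blockMatrix P h *ᵥ y) :=
  (div_nonneg (dotProduct_self_nonneg_real y)
    (by linarith [one_le_mul_dotProduct_add_one hP h])).trans (blockForm_ge hP h y)

lemma blockForm_antitone {P P' : ℝ} (hP : 0 ≤ P) (hPP : P ≤ P') (h y : Fin L → ℝ) :
    y ⬝ᵥ (blockMatrix P' h *ᵥ y) ≤ y ⬝ᵥ (blockMatrix P h *ᵥ y) := by
  rw [dotProduct_blockMatrix_mulVec, dotProduct_blockMatrix_mulVec]
  have h1 := one_le_mul_dotProduct_add_one hP h
  have h2 := one_le_mul_dotProduct_add_one (hP.trans hPP) h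
  have : P / (P * (h ⬝ᵥ h) + 1) ≤ P' / (P' * (h ⬝ᵥ h) + 1) := by
    rw [div_le_div_iff₀ (by linarith) (by linarith)]
    nlinarith
  nlinarith [sq_nonneg (h ⬝ᵥ y)]

lemma norm_sq_le_dotProduct (y : Fin L → ℝ) : ‖y‖ ^ 2 ≤ y ⬝ᵥ y := by
  have : ‖y‖ ≤ √(y ⬝ᵥ y) := by
    refine (pi_norm_le_iff_of_nonneg (Real.sqrt_nonneg _)).2 fun i => ?_
    refine Real.le_sqrt_of_sq_le ?_
    rw [Real.norm_eq_abs, sq_abs, sq]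
    exact Finset.single_le_sum (f := fun i => y i * y i) (fun i _ => mul_self_nonneg (y i))
      (Finset.mem_univ i)
  calc ‖y‖ ^ 2 ≤ √(y ⬝ᵥ y) ^ 2 := by gcongr
    _ = _ := Real.sq_sqrt (dotProduct_self_nonneg_real y)

lemma dotProduct_self_le_norm_sq (y : Fin L → ℝ) : y ⬝ᵥ y ≤ L * ‖y‖ ^ 2 := by
  have : ∀ i ∈ Finset.univ, y i * y i ≤ ‖y‖ ^ 2 := fun i _ => by
    rw [← sq, ← sq_abs]
    gcongr
    exact norm_le_pi_norm y i
  simpa [dotProduct] using Finset.sum_le_sum this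

/-- A vector with small value of the block form is bounded, and nearly parallel to the channel. -/
lemma bounds_of_blockForm_lt {P r R : ℝ} (hP : 1 ≤ P) {h y : Fin L → ℝ}
    (hr : 0 ≤ r) (hR : ‖h‖ ≤ R) (hF : y ⬝ᵥ (blockMatrix P h *ᵥ y) < r ^ 2) :
    ‖y‖ ≤ √(L * R ^ 2 + 1) * r * √P ∧
      ∀ i k, |h i * y k - h k * y i| ≤ √(L * R ^ 2 + 1) * r := by
  have hP0 : 0 ≤ P := by linarith
  have hC : 0 ≤ L * R ^ 2 + 1 := by positivity
  have hh : h ⬝ᵥ h ≤ L * R ^ 2 := (dotProduct_self_le_norm_sq h).trans (by gcongr)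
  have h0 := dotProduct_self_nonneg_real h
  -- P ≥ 1 absorbs the added 1, which makes the constant independent of P.
  have hx : P * (h ⬝ᵥ h) + 1 ≤ P * (L * R ^ 2 + 1) := by nlinarith
  have key := blockForm_mul_eq hP0 h y
  have h1 := one_le_mul_dotProduct_add_one hP0 h
  have hCS := sub_nonneg.2 (dotProduct_sq_le h y)
  have hub : y ⬝ᵥ y + P * ((h ⬝ᵥ h) * (y ⬝ᵥ y) - (h ⬝ᵥ y) ^ 2) ≤ r ^ 2 * (P * (L * R ^ 2 + 1)) := by
    rw [← key]
    have := blockForm_nonneg hP0 h y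
    gcongr
  constructor
  · refine abs_le_of_sq_le_sq' ?_ (by positivity) |>.2
    rw [mul_pow, mul_pow, Real.sq_sqrt hC, Real.sq_sqrt hP0]
    have := norm_sq_le_dotProduct y
    have := mul_nonneg hP0 hCS
    nlinarith
  · intro i k
    refine abs_le_of_sq_le_sq ?_ (by positivity)
    rw [mul_pow, Real.sq_sqrt hC]
    have h2 := sq_minor_le h y i k
    have h3 := dotProduct_self_nonneg_real y
    have h4 : P * (h i * y k - h k * y i) ^ 2 ≤ P * ((L * R ^ 2 + 1) * r ^ 2) := by
      have := mul_le_mul_of_nonneg_left h2 hP0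
      nlinarith
    exact le_of_mul_le_mul_left h4 (by linarith)

/-- The block form is a sum of squares of linear forms, the last of which is proportional to a
prescribed one. -/
lemma exists_adapted_factor {m : ℕ} {P : ℝ} (hP : 0 ≤ P) (h c : Fin (m + 1) → ℝ) (hc : c ≠ 0) :
    ∃ D : Matrix (Fin (m + 1)) (Fin (m + 1)) ℝ,
      D.det ^ 2 * (P * (h ⬝ᵥ h) + 1) = 1 ∧
      (∀ y, y ⬝ᵥ (blockMatrix P h *ᵥ y) = (D *ᵥ y) ⬝ᵥ (D *ᵥ y)) ∧
      ∀ y, c ⬝ᵥ y = 0 → (D *ᵥ y) (Fin.last m) = 0 := by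
  set s := h ⬝ᵥ h with hs
  have h1 : 1 ≤ P * s + 1 := one_le_mul_dotProduct_add_one hP h
  have hs0 : 0 ≤ s := dotProduct_self_nonneg_real h
  set w := 1 / √(P * s + 1) with hw
  have hw0 : 0 < w := by positivity
  have hw2 : w ^ 2 * (P * s + 1) = 1 := by
    rw [hw, div_pow, Real.sq_sqrt (by linarith)]
    field_simp
  -- β makes I - β h hᵀ the symmetric square root of the block matrix, with eigenvalue w along h.
  -- This form of (1 - w)/s remains valid when s = 0.
  set β := P * w ^ 2 / (1 + w) with hβ
  have hβ1 : β * (1 + w) = P * w ^ 2 := by rw [hβ]; field_simp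
  have hβs : 1 - β * s = w := by
    have : (1 - β * s) * (1 + w) = w * (1 + w) := by linear_combination -hw2 - s * hβ1
    exact mul_right_cancel₀ (by positivity) this
  set A : Matrix (Fin (m + 1)) (Fin (m + 1)) ℝ := 1 - β • Matrix.vecMulVec h h with hA
  have hAT : Aᵀ = A := by
    rw [hA, Matrix.transpose_sub, Matrix.transpose_one, Matrix.transpose_smul,
      Matrix.transpose_vecMulVec]
  have hAdet : A.det = w := by
    have : A = 1 + Matrix.replicateCol Unit ((-β) • h) * Matrix.replicateRow Unit h := by
      rw [← Matrix.vecMulVec_eq, hA, Matrix.smul_vecMulVec, neg_smul, sub_eq_add_neg]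
    rw [this, Matrix.det_one_add_replicateCol_mul_replicateRow, dotProduct_smul, ← hβs, ← hs]
    simp; ring
  have hAy : ∀ y, A *ᵥ y = y - (β * (h ⬝ᵥ y)) • h := fun y => by
    rw [hA, Matrix.sub_mulVec, Matrix.one_mulVec, Matrix.smul_mulVec, Matrix.vecMulVec_mulVec,
      op_smul_eq_smul, smul_smul]
  have hform : ∀ y, y ⬝ᵥ (blockMatrix P h *ᵥ y) = (A *ᵥ y) ⬝ᵥ (A *ᵥ y) := fun y => by
    rw [dotProduct_blockMatrix_mulVec, hAy]
    simp only [dotProduct_sub, sub_dotProduct, dotProduct_smul, smul_dotProduct, smul_eq_mul,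
      dotProduct_comm y h, ← hs]
    have hγ : P / (P * s + 1) = P * w ^ 2 := by
      rw [div_eq_iff (by linarith)]
      linear_combination -P * hw2
    rw [hγ]
    linear_combination (h ⬝ᵥ y) ^ 2 * (hβ1 + β * hβs)
  have hAu : IsUnit A.det := by rw [hAdet]; exact hw0.ne'.isUnit
  -- An orthogonal U whose last row is proportional to d gives (U A y)_last ∝ d ⬝ A y = A d ⬝ y = c
  -- ⬝ y, as A is symmetric.
  set d := A⁻¹ *ᵥ c with hd
  have hAd : A *ᵥ d = c := by
    rw [hd, Matrix.mulVec_mulVec, Matrix.mul_nonsing_inv _ hAu, Matrix.one_mulVec]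
  have hd0 : d ≠ 0 := fun h0 => hc (by rw [← hAd, h0, Matrix.mulVec_zero])
  set d' : EuclideanSpace ℝ (Fin (m + 1)) := WithLp.toLp 2 d with hd'
  have hd'0 : d' ≠ 0 := fun h0 => hd0 (by simpa [hd'] using h0)
  obtain ⟨b, hb⟩ := Orthonormal.exists_orthonormalBasis_extension_of_card_eq
    (𝕜 := ℝ) (E := EuclideanSpace ℝ (Fin (m + 1))) (ι := Fin (m + 1)) (by simp)
    (v := fun _ => (‖d'‖⁻¹ : ℝ) • d') (s := {Fin.last m}) (by
      constructor
      · rintro ⟨i, hi⟩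
        simp [Set.domRestrict, norm_smul, hd'0]
      · rintro ⟨i, hi⟩ ⟨j, hj⟩ hij
        exact absurd (Subtype.ext (hi.trans hj.symm)) hij)
  set U : Matrix (Fin (m + 1)) (Fin (m + 1)) ℝ := Matrix.of fun i l => b i l with hU
  have hUU : U * Uᵀ = 1 := by
    ext i j
    rw [Matrix.mul_apply, Matrix.one_apply, ← orthonormal_iff_ite.1 b.orthonormal i j]
    simp [hU, PiLp.inner_apply, Matrix.transpose_apply, mul_comm]
  have hUU' : Uᵀ * U = 1 := mul_eq_one_comm.1 hUU
  refine ⟨U * A, ?_, ?_, ?_⟩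
  · have : U.det ^ 2 = 1 := by
      have := congrArg Matrix.det hUU
      rw [Matrix.det_mul, Matrix.det_transpose, Matrix.det_one] at this
      rw [sq, this]
    rw [Matrix.det_mul, mul_pow, this, hAdet, one_mul, hw2]
  · intro y
    rw [hform, ← Matrix.mulVec_mulVec, Matrix.dotProduct_mulVec _ U, ← Matrix.mulVec_transpose,
      Matrix.mulVec_mulVec, hUU', Matrix.one_mulVec]
  · intro y hy
    rw [← Matrix.mulVec_mulVec]
    have hlast : ∀ z : Fin (m + 1) → ℝ, (U *ᵥ z) (Fin.last m) = ‖d'‖⁻¹ * (d ⬝ᵥ z) := fun z => by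
      rw [Matrix.mulVec, hU, dotProduct, dotProduct, Finset.mul_sum]
      refine Finset.sum_congr rfl fun l _ => ?_
      rw [Matrix.of_apply, hb (Fin.last m) rfl]
      simp [hd', mul_assoc]
    rw [hlast, Matrix.dotProduct_mulVec, ← Matrix.mulVec_transpose, hAT, hAd, hy, mul_zero]

end BlockForm

/-! ### The Humbert form as a sum over blocks -/

section Humbert

variable {K : Type*} [Field K] {n L : ℕ}

lemma humbertForm_nonneg (σ : Fin n → (K →+* ℝ)) (H : Fin L → Fin n → ℝ) {P : ℝ} (hP : 0 ≤ P)
    (a : Fin L → 𝓞 K) : 0 ≤ humbertForm σ H P a :=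
  Finset.sum_nonneg fun _ _ => blockForm_nonneg hP _ _

lemma humbertForm_antitone (σ : Fin n → (K →+* ℝ)) (H : Fin L → Fin n → ℝ) {P P' : ℝ}
    (hP : 0 ≤ P) (hPP : P ≤ P') (a : Fin L → 𝓞 K) :
    humbertForm σ H P' a ≤ humbertForm σ H P a :=
  Finset.sum_le_sum fun _ _ => blockForm_antitone hP hPP _ _

lemma blockForm_le_humbertForm (σ : Fin n → (K →+* ℝ)) (H : Fin L → Fin n → ℝ) {P : ℝ}
    (hP : 0 ≤ P) (a : Fin L → 𝓞 K) (j : Fin n) :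
    embedVec (σ j) a ⬝ᵥ (blockMatrix P (blockVector H j) *ᵥ embedVec (σ j) a)
      ≤ humbertForm σ H P a :=
  Finset.single_le_sum
    (f := fun j => embedVec (σ j) a ⬝ᵥ (blockMatrix P (blockVector H j) *ᵥ embedVec (σ j) a))
    (fun _ _ => blockForm_nonneg hP _ _) (Finset.mem_univ j)

lemma embedVec_ne_zero (s : K →+* ℝ) {a : Fin L → 𝓞 K} (ha : a ≠ 0) : embedVec s a ≠ 0 := by
  contrapose! ha
  ext l
  have : s (a l : K) = 0 := congrFun ha l
  simpa using this

end Humbert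

/-! ### Norms and counting integers in boxes -/

section NumberField

variable {K : Type*} [Field K] [NumberField K] {n L : ℕ}

/-- There are as many real embeddings as the degree, so composed with ℝ → ℂ they exhaust the complex
embeddings in the norm formula. -/
lemma prod_abs_embedding (hn : Module.finrank ℚ K = n) (σ : Fin n ≃ (K →+* ℝ)) (x : K) :
    ∏ j, |σ j x| = |((Algebra.norm ℚ x : ℚ) : ℝ)| := by
  let e : Fin n → (K →ₐ[ℚ] ℂ) := fun j =>
    RingHom.equivRatAlgHom K ℂ (Complex.ofRealHom.comp (σ j))
  have he : Function.Bijective e := by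
    rw [Fintype.bijective_iff_injective_and_card]
    refine ⟨fun i j hij => ?_, ?_⟩
    · have h1 := (RingHom.equivRatAlgHom K ℂ).injective hij
      refine σ.injective (RingHom.ext fun y => ?_)
      exact Complex.ofReal_injective (RingHom.congr_fun h1 y)
    · rw [← Fintype.card_congr (RingHom.equivRatAlgHom K ℂ), NumberField.Embeddings.card, hn,
        Fintype.card_fin]
  have h := Algebra.norm_eq_prod_embeddings ℚ ℂ x
  rw [← he.prod_comp (fun φ => φ x)] at h
  have h2 : (∏ j, (e j) x) = ((∏ j, σ j x : ℝ) : ℂ) := by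
    rw [Complex.ofReal_prod]
    rfl
  have h3 : ((Algebra.norm ℚ x : ℚ) : ℝ) = ∏ j, σ j x := by
    apply Complex.ofReal_injective
    rw [← h2, ← h]
    simp
  rw [h3, Finset.abs_prod]

lemma one_le_prod_abs_embedding (hn : Module.finrank ℚ K = n) (σ : Fin n ≃ (K →+* ℝ))
    {x : 𝓞 K} (hx : x ≠ 0) : 1 ≤ ∏ j, |σ j (x : K)| := by
  rw [prod_abs_embedding hn, ← Algebra.coe_norm_int]
  have : Algebra.norm ℤ x ≠ 0 := Algebra.norm_ne_zero_iff.2 hx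
  have h := Int.one_le_abs this
  simpa using (Int.cast_le (R := ℝ)).2 h

lemma one_le_prod_norm_embedVec (hn : Module.finrank ℚ K = n) (σ : Fin n ≃ (K →+* ℝ))
    {a : Fin L → 𝓞 K} (ha : a ≠ 0) : 1 ≤ ∏ j, ‖embedVec (σ j) a‖ := by
  obtain ⟨l, hl⟩ := Function.ne_iff.1 ha
  refine (one_le_prod_abs_embedding hn σ hl).trans ?_
  exact Finset.prod_le_prod (fun _ _ => abs_nonneg _) fun j _ => norm_le_pi_norm (embedVec (σ j) a) l

/-- The number of integers in a box is at most a constant times the volume of the box. -/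
lemma finite_and_ncard_box_le (hn : Module.finrank ℚ K = n) (σ : Fin n ≃ (K →+* ℝ))
    {B : Fin n → ℝ} (hB : ∀ j, 0 < B j) (hB1 : 1 ≤ ∏ j, B j) :
    {x : 𝓞 K | ∀ j, |σ j (x : K)| ≤ B j}.Finite ∧
      ({x : 𝓞 K | ∀ j, |σ j (x : K)| ≤ B j}.ncard : ℝ) ≤ 4 ^ n * ∏ j, B j := by
  have hn0 : 0 < n := hn ▸ Module.finrank_pos
  -- The geometric mean of the sides: cells with sides `B j / b` have volume 1, so two integers in
  -- one cell would differ by an element of norm less than 1 and must coincide.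
  set b : ℝ := (∏ j, B j) ^ (1 / (n : ℝ)) with hb
  have hb1 : 1 ≤ b := Real.one_le_rpow hB1 (by positivity)
  have hbn : b ^ n = ∏ j, B j := by
    rw [hb, ← Real.rpow_natCast, ← Real.rpow_mul (by linarith), one_div,
      inv_mul_cancel₀ (by positivity), Real.rpow_one]
  have hb0 : 0 < b := by linarith
  let f : 𝓞 K → Fin n → ℤ := fun x j => ⌊σ j (x : K) * b / B j⌋
  let T : Finset (Fin n → ℤ) := Fintype.piFinset fun _ => Finset.Icc ⌊-b⌋ ⌊b⌋
  have hmaps : ∀ x ∈ {x : 𝓞 K | ∀ j, |σ j (x : K)| ≤ B j}, f x ∈ (T : Set (Fin n → ℤ)) := by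
    intro x hx
    simp only [T, Finset.mem_coe, Fintype.mem_piFinset, Finset.mem_Icc]
    intro j
    have h1 := abs_le.1 (hx j)
    constructor
    · refine Int.floor_le_floor ?_
      rw [le_div_iff₀ (hB j)]
      nlinarith [h1.1]
    · refine Int.floor_le_floor ?_
      rw [div_le_iff₀ (hB j)]
      nlinarith [h1.2]
  have hinj : Function.Injective f := by
    intro x y hxy
    by_contra hne
    have h1 := one_le_prod_abs_embedding hn σ (sub_ne_zero.2 hne)
    have h2 : ∏ j, |σ j ((x - y : 𝓞 K) : K)| < ∏ j, (B j / b) := by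
      refine Finset.prod_lt_prod_of_nonempty (fun j _ => abs_pos.2 ?_) (fun j _ => ?_)
        ⟨⟨0, hn0⟩, Finset.mem_univ _⟩
      · exact (map_ne_zero (σ j)).2 (RingOfIntegers.coe_ne_zero_iff.2 (sub_ne_zero.2 hne))
      · have := Int.abs_sub_lt_one_of_floor_eq_floor (congrFun hxy j)
        rw [← sub_div, abs_div, abs_of_pos (hB j), div_lt_one (hB j), ← sub_mul, abs_mul,
          abs_of_pos hb0] at this
        rw [lt_div_iff₀ hb0]
        simpa using this
    have h3 : ∏ j, (B j / b) = 1 := by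
      rw [Finset.prod_div_distrib, Finset.prod_const, Finset.card_fin, hbn, div_self]
      linarith
    linarith
  refine ⟨Set.Finite.of_injOn hmaps hinj.injOn T.finite_toSet, ?_⟩
  have hcard := Set.ncard_le_ncard_of_injOn f hmaps hinj.injOn T.finite_toSet
  rw [Set.ncard_coe_finset, Fintype.card_piFinset, Finset.prod_const, Finset.card_fin,
    Int.card_Icc] at hcard
  -- The count is at most 2b + 2, and b ≥ 1.
  have h5 : ((⌊b⌋ + 1 - ⌊-b⌋).toNat : ℝ) ≤ 4 * b := by
    have h6 : 0 ≤ ⌊b⌋ + 1 - ⌊-b⌋ := by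
      have : ⌊-b⌋ ≤ ⌊b⌋ := Int.floor_le_floor (by linarith)
      omega
    have h7 : ((⌊b⌋ + 1 - ⌊-b⌋).toNat : ℝ) = ((⌊b⌋ + 1 - ⌊-b⌋ : ℤ) : ℝ) := by
      exact_mod_cast Int.toNat_of_nonneg h6
    rw [h7]
    push_cast
    have := Int.floor_le b
    have := Int.lt_floor_add_one (-b)
    linarith
  calc _ ≤ (((⌊b⌋ + 1 - ⌊-b⌋).toNat ^ n : ℕ) : ℝ) := by exact_mod_cast hcard
    _ ≤ (4 * b) ^ n := by
      push_cast
      gcongr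
    _ = _ := by rw [mul_pow, hbn]

lemma finite_and_ncard_vec_box_le (hn : Module.finrank ℚ K = n) (σ : Fin n ≃ (K →+* ℝ))
    {B : Fin n → ℝ} (hB : ∀ j, 0 < B j) (hB1 : 1 ≤ ∏ j, B j) :
    {a : Fin L → 𝓞 K | ∀ j, ‖embedVec (σ j) a‖ ≤ B j}.Finite ∧
      ({a : Fin L → 𝓞 K | ∀ j, ‖embedVec (σ j) a‖ ≤ B j}.ncard : ℝ)
        ≤ (4 ^ n * ∏ j, B j) ^ L := by
  obtain ⟨hfin, hcard⟩ := finite_and_ncard_box_le hn σ hB hB1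
  have heq : {a : Fin L → 𝓞 K | ∀ j, ‖embedVec (σ j) a‖ ≤ B j}
      = ((Fintype.piFinset fun _ : Fin L => hfin.toFinset : Finset (Fin L → 𝓞 K)) : Set _) := by
    ext a
    simp only [Set.mem_ofPred_eq, Finset.mem_coe, Fintype.mem_piFinset, Set.Finite.mem_toFinset]
    constructor
    · exact fun h l j => (norm_le_pi_norm (embedVec (σ j) a) l).trans (h j)
    · exact fun h j => (pi_norm_le_iff_of_nonneg (hB j).le).2 fun l => h l j
  rw [heq]
  refine ⟨Finset.finite_toSet _, ?_⟩
  rw [Set.ncard_coe_finset, Fintype.card_piFinset, Finset.prod_const, Finset.card_fin,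
    ← Set.ncard_eq_toFinset_card _ hfin]
  push_cast
  gcongr

lemma finite_humbertForm_le (hn : Module.finrank ℚ K = n) (σ : Fin n ≃ (K →+* ℝ))
    (H : Fin L → Fin n → ℝ) {P : ℝ} (hP : 0 ≤ P) (t : ℝ) :
    {a : Fin L → 𝓞 K | humbertForm σ H P a ≤ t}.Finite := by
  -- The 1 secures the hypothesis of the box count that the sides have product at least 1.
  let B : Fin n → ℝ := fun j => max 1 (√(t * (P * (blockVector H j ⬝ᵥ blockVector H j) + 1)))
  have hB : ∀ j, 1 ≤ B j := fun j => le_max_left _ _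
  have hB1 : 1 ≤ ∏ j, B j := by
    simpa using Finset.prod_le_prod (s := Finset.univ) (f := fun _ : Fin n => (1 : ℝ))
      (fun _ _ => zero_le_one) fun j _ => hB j
  refine (finite_and_ncard_vec_box_le (L := L) hn σ (B := B)
    (fun j => by linarith [hB j]) hB1).1.subset ?_
  intro a ha j
  refine le_trans (Real.le_sqrt_of_sq_le ?_) (le_max_right _ _)
  have h1 := one_le_mul_dotProduct_add_one hP (blockVector H j)
  refine (norm_sq_le_dotProduct _).trans ?_
  rw [← div_le_iff₀ (by linarith)]
  exact (blockForm_ge hP _ _).trans ((blockForm_le_humbertForm σ H hP a j).trans ha)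

end NumberField

/-! ### Existence and monotonicity of the successive minima -/

section Existence

variable {K : Type*} [Field K] {n L : ℕ}

lemma exists_coe_notMem_of_finrank_lt {V : Submodule K (Fin L → K)}
    (hV : Module.finrank K V < L) : ∃ a : Fin L → 𝓞 K, (fun l => (a l : K)) ∉ V := by
  by_contra! h
  have : V = ⊤ := by
    rw [eq_top_iff, ← (Pi.basisFun K (Fin L)).span_eq, Submodule.span_le]
    rintro _ ⟨i, rfl⟩
    have h1 := h (Pi.single i 1)
    have h2 : (fun l => ((Pi.single i 1 : Fin L → 𝓞 K) l : K)) = Pi.basisFun K (Fin L) i := by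
      ext l
      by_cases hl : l = i
      · subst hl; simp
      · simp [hl]
    rwa [h2] at h1
  rw [this, finrank_top, Module.finrank_fin_fun] at hV
  exact lt_irrefl _ hV

/-- Greedy choice: the next vector is a shortest one outside the span of those already chosen, which
exists since balls are finite. The third clause is the induction invariant showing that the earlier
vectors lie in the ball of the new radius. -/
lemma exists_partial_attain [NumberField K] (hn : Module.finrank ℚ K = n) (σ : Fin n ≃ (K →+* ℝ))
    (H : Fin L → Fin n → ℝ) {P : ℝ} (hP : 0 ≤ P) (k : ℕ) (hk : k ≤ L) :
    ∃ b : Fin k → Fin L → 𝓞 K,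
      LinearIndependent K (fun i : Fin k => fun l : Fin L => (b i l : K)) ∧
      (∀ i : Fin k, √(humbertForm σ H P (b i)) = succMin σ H P (i + 1)) ∧
      ∀ x : Fin L → 𝓞 K, (fun l => (x l : K)) ∉
        Submodule.span K (Set.range fun i : Fin k => fun l : Fin L => (b i l : K)) →
        ∀ i, humbertForm σ H P (b i) ≤ humbertForm σ H P x := by
  induction k with
  | zero => exact ⟨Fin.elim0, linearIndependent_empty_type, fun i => i.elim0, fun _ _ i => i.elim0⟩
  | succ k ih =>
    obtain ⟨b, hli, hmin, hle⟩ := ih (by omega)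
    set V := Submodule.span K (Set.range fun i : Fin k => fun l : Fin L => (b i l : K)) with hV
    have hVk : Module.finrank K V = k := by
      rw [hV, finrank_span_eq_card hli, Fintype.card_fin]
    obtain ⟨a₀, ha₀⟩ := exists_coe_notMem_of_finrank_lt (V := V) (by omega)
    obtain ⟨a, ⟨ha1, ha2⟩, hamin⟩ := Set.exists_min_image
      {x : Fin L → 𝓞 K | humbertForm σ H P x ≤ humbertForm σ H P a₀ ∧ (fun l => (x l : K)) ∉ V}
      (humbertForm σ H P)
      ((finite_humbertForm_le hn σ H hP (humbertForm σ H P a₀)).subset fun x hx => hx.1)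
      ⟨a₀, le_rfl, ha₀⟩
    have hamin' : ∀ x : Fin L → 𝓞 K, (fun l => (x l : K)) ∉ V →
        humbertForm σ H P a ≤ humbertForm σ H P x := fun x hx => by
      rcases le_total (humbertForm σ H P x) (humbertForm σ H P a₀) with h | h
      · exact hamin x ⟨h, hx⟩
      · exact ha1.trans h
    have hsnoc : (fun i : Fin (k + 1) => fun l : Fin L => ((Fin.snoc b a : Fin (k + 1) → _) i l : K))
        = Fin.snoc (fun i : Fin k => fun l : Fin L => (b i l : K)) (fun l => (a l : K)) := by
      funext i
      refine Fin.lastCases ?_ (fun i => ?_) i <;> simp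
    have hli' : LinearIndependent K (fun i : Fin (k + 1) => fun l : Fin L =>
        ((Fin.snoc b a : Fin (k + 1) → _) i l : K)) := by
      rw [hsnoc, linearIndependent_finSnoc]
      exact ⟨hli, ha2⟩
    have hle' : ∀ i, humbertForm σ H P ((Fin.snoc b a : Fin (k + 1) → _) i)
        ≤ humbertForm σ H P a := by
      intro i
      refine Fin.lastCases ?_ (fun i => ?_) i
      · simp
      · simpa using hle a ha2 i
    have hlast : √(humbertForm σ H P a) = succMin σ H P (k + 1) := by
      refine (IsLeast.csInf_eq ⟨?_, ?_⟩).symm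
      · change k + 1 ≤ _
        have h1 := finrank_span_eq_card hli'
        rw [Fintype.card_fin] at h1
        rw [← h1]
        refine Submodule.finrank_mono (Submodule.span_mono ?_)
        rintro _ ⟨i, rfl⟩
        exact ⟨_, rfl, Real.sqrt_le_sqrt (hle' i)⟩
      -- Below the new radius every module vector lies in V, whose dimension is only k.
      · intro r hr
        by_contra! hlt
        have h1 : ballSpan σ H P r ≤ V := by
          refine Submodule.span_le.2 ?_
          rintro _ ⟨x, rfl, hx⟩
          by_contra hxV
          have := Real.sqrt_le_sqrt (hamin' x hxV)
          linarith
        have h2 := Submodule.finrank_mono h1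
        have h3 : k + 1 ≤ Module.finrank K (ballSpan σ H P r) := hr
        omega
    refine ⟨Fin.snoc b a, hli', fun i => ?_, fun x hx i => ?_⟩
    · refine Fin.lastCases ?_ (fun i => ?_) i
      · simpa using hlast
      · simpa using hmin i
    · have hxV : (fun l => (x l : K)) ∉ V := fun h => hx <| by
        refine Submodule.span_mono ?_ h
        rintro _ ⟨i, rfl⟩
        exact ⟨i.castSucc, by simp⟩
      exact (hle' i).trans (hamin' x hxV)

lemma exists_attainsSuccMin [NumberField K] (hn : Module.finrank ℚ K = n) (σ : Fin n ≃ (K →+* ℝ))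
    (H : Fin L → Fin n → ℝ) {P : ℝ} (hP : 0 ≤ P) :
    ∃ a : Fin L → Fin L → 𝓞 K, AttainsSuccMin σ H P a := by
  obtain ⟨b, h1, h2, -⟩ := exists_partial_attain hn σ H hP L le_rfl
  exact ⟨b, h1, h2⟩

lemma finrank_ballSpan_lt (σ : Fin n → (K →+* ℝ)) (H : Fin L → Fin n → ℝ) {P r : ℝ} {i : ℕ}
    (hi : 0 < i) (hr : r < succMin σ H P i) : Module.finrank K (ballSpan σ H P r) < i := by
  by_contra! h
  -- The infimum is meaningful only for a set bounded below: a negative radius gives an empty ball,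
  -- of rank 0 < i.
  refine absurd (csInf_le (s := {r : ℝ | i ≤ Module.finrank K (ballSpan σ H P r)})
    ⟨0, fun s hs => ?_⟩ h) (not_le.2 hr)
  by_contra! hs0
  have : ballSpan σ H P s = ⊥ := by
    rw [ballSpan, Submodule.span_eq_bot]
    rintro x ⟨a, -, ha⟩
    linarith [Real.sqrt_nonneg (humbertForm σ H P a)]
  have hs' : i ≤ Module.finrank K (ballSpan σ H P s) := hs
  rw [this, finrank_bot] at hs'
  omega

/-- The successive minima are increasing. -/
lemma AttainsSuccMin.humbertForm_le_last {m : ℕ} {σ : Fin n → (K →+* ℝ)}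
    {H : Fin (m + 1) → Fin n → ℝ} {P : ℝ} (hP : 0 ≤ P)
    {a : Fin (m + 1) → Fin (m + 1) → 𝓞 K} (ha : AttainsSuccMin σ H P a) (i : Fin (m + 1)) :
    humbertForm σ H P (a i) ≤ humbertForm σ H P (a (Fin.last m)) := by
  by_contra! hlt
  have h1 := Real.sqrt_lt_sqrt (humbertForm_nonneg σ H hP _) hlt
  rw [ha.2, ha.2] at h1
  -- Nonemptiness matters because the real infimum of ∅ is 0; the sum of all the lengths is a radius
  -- whose ball contains every a k.
  refine absurd (le_csInf (s := {r : ℝ | m + 1 ≤ Module.finrank K (ballSpan σ H P r)})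
    ⟨∑ k, √(humbertForm σ H P (a k)), ?_⟩ fun r hr => ?_) (not_le.2 h1)
  · change m + 1 ≤ _
    have h2 := finrank_span_eq_card ha.1
    rw [Fintype.card_fin] at h2
    refine h2.ge.trans (Submodule.finrank_mono (Submodule.span_mono ?_))
    rintro _ ⟨k, rfl⟩
    exact ⟨_, rfl, Finset.single_le_sum (f := fun k => √(humbertForm σ H P (a k)))
      (fun _ _ => Real.sqrt_nonneg _) (Finset.mem_univ k)⟩
  · by_contra! hlt'
    have h3 := finrank_ballSpan_lt σ H (Nat.succ_pos i) hlt'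
    have h4 : m + 1 ≤ Module.finrank K (ballSpan σ H P r) := hr
    have := i.isLt
    omega

end Existence

/-! ### Volume of the channels admitting a short vector -/

section Measure

/-- The volume of the set of bounded vectors nearly parallel to a given vector. -/
lemma volume_nearly_parallel_le {m : ℕ} {y : Fin (m + 1) → ℝ} (hy : y ≠ 0) {R δ : ℝ}
    (hδ : 0 ≤ δ) :
    volume {h : Fin (m + 1) → ℝ | ‖h‖ ≤ R ∧ ∀ i k, |h i * y k - h k * y i| ≤ δ}
      ≤ ENNReal.ofReal (2 * R * (2 * (δ / ‖y‖)) ^ m) := by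
  rcases lt_or_ge R 0 with hR | hR
  · have : {h : Fin (m + 1) → ℝ | ‖h‖ ≤ R ∧ ∀ i k, |h i * y k - h k * y i| ≤ δ} = ∅ := by
      refine Set.eq_empty_of_forall_notMem fun h hh => ?_
      have := hh.1
      linarith [norm_nonneg h]
    simp [this]
  -- Slice along a coordinate l where |y| is largest. Given h_l, the minors involving l pin every
  -- other h_k to an interval of half-width δ/‖y‖.
  obtain ⟨l, -, hl⟩ := Finset.exists_max_image Finset.univ (fun i => |y i|) ⟨0, Finset.mem_univ _⟩
  have hnorm : ‖y‖ = |y l| := le_antisymm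
    ((pi_norm_le_iff_of_nonneg (abs_nonneg _)).2 fun i => hl i (Finset.mem_univ i))
    (norm_le_pi_norm y l)
  have hyl : y l ≠ 0 := abs_pos.1 (hnorm ▸ norm_pos_iff.2 hy)
  let c : Fin m → ℝ := fun k => y (l.succAbove k) / y l
  let S : Set (ℝ × (Fin m → ℝ)) :=
    {p | p.1 ∈ Set.Icc (-R) R ∧ ∀ k, p.2 k - p.1 * c k ∈ Set.Icc (-(δ / ‖y‖)) (δ / ‖y‖)}
  have hS : MeasurableSet S := by
    have : S = (Prod.fst ⁻¹' Set.Icc (-R) R) ∩ ⋂ k, (fun p : ℝ × (Fin m → ℝ) =>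
        p.2 k - p.1 * c k) ⁻¹' Set.Icc (-(δ / ‖y‖)) (δ / ‖y‖) := by
      ext p
      simp [S]
    rw [this]
    exact (measurable_fst measurableSet_Icc).inter
      (MeasurableSet.iInter fun k => (by fun_prop : Measurable _) measurableSet_Icc)
  have hsub : {h : Fin (m + 1) → ℝ | ‖h‖ ≤ R ∧ ∀ i k, |h i * y k - h k * y i| ≤ δ}
      ⊆ MeasurableEquiv.piFinSuccAbove (fun _ => ℝ) l ⁻¹' S := by
    rintro h ⟨h1, h2⟩
    refine ⟨abs_le.1 ((norm_le_pi_norm h l).trans h1), fun k => abs_le.1 ?_⟩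
    have h3 := h2 (l.succAbove k) l
    change |h (l.succAbove k) - h l * (y (l.succAbove k) / y l)| ≤ _
    rw [hnorm, le_div_iff₀ (abs_pos.2 hyl), ← abs_mul]
    have h4 : (h (l.succAbove k) - h l * (y (l.succAbove k) / y l)) * y l
        = h (l.succAbove k) * y l - h l * y (l.succAbove k) := by
      field_simp
    rwa [h4]
  refine (measure_mono hsub).trans ?_
  rw [(volume_preserving_piFinSuccAbove (fun _ => ℝ) l).measure_preimage hS.nullMeasurableSet,
    Measure.volume_eq_prod, Measure.prod_apply hS]
  have hslice : ∀ t : ℝ, volume (Prod.mk t ⁻¹' S) ≤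
      (Set.Icc (-R) R).indicator (fun _ => ENNReal.ofReal ((2 * (δ / ‖y‖)) ^ m)) t := by
    intro t
    by_cases ht : t ∈ Set.Icc (-R) R
    · rw [Set.indicator_of_mem ht]
      have : Prod.mk t ⁻¹' S ⊆ Set.Icc (fun k => t * c k - δ / ‖y‖) (fun k => t * c k + δ / ‖y‖) := by
        rintro z ⟨-, hz⟩
        exact ⟨fun k => by linarith [(hz k).1], fun k => by linarith [(hz k).2]⟩
      refine (measure_mono this).trans ?_
      rw [Real.volume_Icc_pi, ENNReal.ofReal_pow (by positivity)]
      simp only [add_sub_sub_cancel, Finset.prod_const, Finset.card_fin, two_mul]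
      exact le_rfl
    · have : Prod.mk t ⁻¹' S = ∅ := Set.eq_empty_of_forall_notMem fun z hz => ht hz.1
      simp [this]
  refine (lintegral_mono hslice).trans ?_
  rw [lintegral_indicator_const measurableSet_Icc, Real.volume_Icc,
    ← ENNReal.ofReal_mul (by positivity)]
  refine ENNReal.ofReal_le_ofReal (le_of_eq ?_)
  ring

variable {K : Type*} [Field K] [NumberField K] {n m : ℕ}

/-- Vectors in a dyadic cell. -/
def dyadicCell (σ : Fin n → (K →+* ℝ)) (X : ℝ) (k : Fin n → ℤ) : Set (Fin (m + 1) → 𝓞 K) :=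
  {a | a ≠ 0 ∧ (∀ j, ‖embedVec (σ j) a‖ ≤ X) ∧
    (∀ j, ‖embedVec (σ j) a‖ ≤ 2 ^ k j) ∧ ∀ j, (2 : ℝ) ^ (k j - 1) < ‖embedVec (σ j) a‖}

/-- The box count gives D^(m+1) for D = ∏ 2^(k_j). One factor D is traded for (2X)^n, leaving
exactly the D^m that the volume estimate will cancel. An element of the cell is what guarantees D ≥
1, hence the separate empty case. -/
lemma dyadicCell_finite_and_ncard_le (hn : Module.finrank ℚ K = n) (σ : Fin n ≃ (K →+* ℝ))
    {X : ℝ} (hX : 0 ≤ X) (k : Fin n → ℤ) :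
    (dyadicCell (m := m) σ X k).Finite ∧
      ((dyadicCell (m := m) σ X k).ncard : ℝ)
        ≤ (4 ^ n) ^ (m + 1) * (∏ j, (2 : ℝ) ^ k j) ^ m * (2 * X) ^ n := by
  rcases (dyadicCell (m := m) σ X k).eq_empty_or_nonempty with he | ⟨a, ha0, ha1, ha2, ha3⟩
  · rw [he]
    refine ⟨Set.finite_empty, ?_⟩
    rw [Set.ncard_empty, Nat.cast_zero]
    positivity
  · have hD1 : 1 ≤ ∏ j, (2 : ℝ) ^ k j := (one_le_prod_norm_embedVec hn σ ha0).trans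
      (Finset.prod_le_prod (fun _ _ => norm_nonneg _) fun j _ => ha2 j)
    have hDX : ∏ j, (2 : ℝ) ^ k j ≤ (2 * X) ^ n := by
      calc ∏ j, (2 : ℝ) ^ k j ≤ ∏ _j : Fin n, (2 * X) := by
            refine Finset.prod_le_prod (fun j _ => by positivity) fun j _ => ?_
            have := (ha3 j).le.trans (ha1 j)
            rw [zpow_sub_one₀ two_ne_zero] at this
            linarith
        _ = _ := by simp
    obtain ⟨hfin, hcard⟩ := finite_and_ncard_vec_box_le (L := m + 1) hn σ
      (B := fun j => (2 : ℝ) ^ k j) (fun j => by positivity) hD1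
    have hsub : dyadicCell σ X k ⊆
        {a : Fin (m + 1) → 𝓞 K | ∀ j, ‖embedVec (σ j) a‖ ≤ (2 : ℝ) ^ k j} := fun a ha => ha.2.2.1
    refine ⟨hfin.subset hsub, ?_⟩
    calc ((dyadicCell (m := m) σ X k).ncard : ℝ) ≤ _ := by
          exact_mod_cast Set.ncard_le_ncard hsub hfin
      _ ≤ _ := hcard
      _ = (4 ^ n) ^ (m + 1) * (∏ j, (2 : ℝ) ^ k j) ^ m * ∏ j, (2 : ℝ) ^ k j := by ring
      _ ≤ _ := by gcongr

/-- Every short vector lies in one of few dyadic cells. -/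
lemma exists_mem_dyadicCell (hn : Module.finrank ℚ K = n) (σ : Fin n ≃ (K →+* ℝ))
    {X : ℝ} {q : ℕ} (hX : X ≤ 2 ^ q) {a : Fin (m + 1) → 𝓞 K} (ha : a ≠ 0)
    (haX : ∀ j, ‖embedVec (σ j) a‖ ≤ X) :
    ∃ k ∈ Fintype.piFinset (fun _ : Fin n => Finset.Icc (-(n * q : ℤ)) q),
      a ∈ dyadicCell σ X k := by
  have hpos : ∀ j, 0 < ‖embedVec (σ j) a‖ := fun j => norm_pos_iff.2 (embedVec_ne_zero _ ha)
  refine ⟨fun j => Int.clog 2 ‖embedVec (σ j) a‖, ?_, ha, haX, fun j => ?_, fun j => ?_⟩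
  · rw [Fintype.mem_piFinset]
    intro j
    rw [Finset.mem_Icc]
    constructor
    -- The product of all the norms is at least 1 and the others are at most 2^q, so no single one
    -- can fall below 2^(-nq).
    · have h1 := one_le_prod_norm_embedVec hn σ ha
      rw [← Finset.mul_prod_erase _ _ (Finset.mem_univ j)] at h1
      have h2 : ∏ i ∈ Finset.univ.erase j, ‖embedVec (σ i) a‖ ≤ ∏ _i : Fin n, (2 : ℝ) ^ q := by
        calc _ ≤ ∏ i ∈ Finset.univ.erase j, (2 : ℝ) ^ q :=
              Finset.prod_le_prod (fun _ _ => norm_nonneg _) fun i _ => (haX i).trans hX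
          _ ≤ _ := by
              rw [Finset.prod_const, Finset.prod_const]
              exact pow_le_pow_right₀ (one_le_pow₀ one_le_two) (Finset.card_erase_le)
      have h3 : (2 : ℝ) ^ (-(n * q : ℤ)) ≤ ‖embedVec (σ j) a‖ := by
        rw [zpow_neg, inv_le_iff_one_le_mul₀ (by positivity)]
        refine h1.trans ?_
        have : (2 : ℝ) ^ (n * q : ℤ) = ∏ _i : Fin n, (2 : ℝ) ^ q := by
          rw [Finset.prod_const, Finset.card_fin, ← pow_mul, mul_comm q n]
          exact_mod_cast rfl
        rw [this]
        exact mul_le_mul_of_nonneg_left h2 (hpos j).le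
      have h4 := Int.clog_mono_right (b := 2) (by positivity) h3
      have h5 := Int.clog_zpow (R := ℝ) (b := 2) one_lt_two (-(n * q : ℤ))
      rw [Nat.cast_ofNat] at h5
      rwa [h5] at h4
    · have h4 := Int.clog_mono_right (b := 2) (hpos j) ((haX j).trans hX)
      have h5 := Int.clog_zpow (R := ℝ) (b := 2) one_lt_two q
      rw [Nat.cast_ofNat, zpow_natCast] at h5
      rwa [h5] at h4
  · exact_mod_cast Int.self_le_zpow_clog (b := 2) one_lt_two ‖embedVec (σ j) a‖
  · exact_mod_cast Int.zpow_pred_clog_lt_self (b := 2) one_lt_two (hpos j)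

/-- The channels of norm at most `R` for which some nonzero vector is shorter than `r`. -/
def shortSet (σ : Fin n → (K →+* ℝ)) (m : ℕ) (R P r : ℝ) : Set (Fin n → Fin (m + 1) → ℝ) :=
  {G | (∀ j, ‖G j‖ ≤ R) ∧ ∃ a : Fin (m + 1) → 𝓞 K, a ≠ 0 ∧
    humbertForm σ (fun l j => G j l) P a < r ^ 2}

/-- Union bound over cells, then over the vectors of a cell. The dyadic sizes cancel, so each cell
costs the same and the number of cells contributes only a power of q. -/
lemma volume_shortSet_le (hn : Module.finrank ℚ K = n) (σ : Fin n ≃ (K →+* ℝ))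
    {R P r : ℝ} (hR : 0 ≤ R) (hP : 1 ≤ P) (hr : 0 ≤ r) {q : ℕ}
    (hq : √((m + 1 : ℕ) * R ^ 2 + 1) * r * √P ≤ 2 ^ q) :
    volume (shortSet σ m R P r) ≤ ENNReal.ofReal (((n + 1) * q + 1) ^ n *
      (R * 16 ^ (m + 1) * √((m + 1 : ℕ) * R ^ 2 + 1) ^ (m + 1) * (r ^ (m + 1) * √P)) ^ n) := by
  set C := √((m + 1 : ℕ) * R ^ 2 + 1) with hC
  have hC0 : 0 ≤ C := Real.sqrt_nonneg _
  set X := C * r * √P with hX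
  have hX0 : 0 ≤ X := by positivity
  let N (a : Fin (m + 1) → 𝓞 K) : Set (Fin n → Fin (m + 1) → ℝ) :=
    Set.univ.pi fun j => {h | ‖h‖ ≤ R ∧
      ∀ i k, |h i * embedVec (σ j) a k - h k * embedVec (σ j) a i| ≤ C * r}
  let I := Fintype.piFinset (fun _ : Fin n => Finset.Icc (-(n * q : ℤ)) q)
  have hfin : ∀ k, (dyadicCell (m := m) σ X k).Finite := fun k =>
    (dyadicCell_finite_and_ncard_le hn σ hX0 k).1
  have hsub : shortSet σ m R P r ⊆ ⋃ k ∈ I, ⋃ a ∈ (hfin k).toFinset, N a := by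
    rintro G ⟨hG, a, ha0, ha⟩
    have hb : ∀ j, ‖embedVec (σ j) a‖ ≤ X ∧ ∀ i k,
        |G j i * embedVec (σ j) a k - G j k * embedVec (σ j) a i| ≤ C * r := fun j =>
      bounds_of_blockForm_lt (h := G j) hP hr (hG j)
        ((blockForm_le_humbertForm σ (fun l j => G j l) (by linarith) a j).trans_lt ha)
    obtain ⟨k, hk, hak⟩ := exists_mem_dyadicCell hn σ hq ha0 fun j => (hb j).1
    simp only [Set.mem_iUnion]
    exact ⟨k, hk, a, (hfin k).mem_toFinset.2 hak, fun j _ => ⟨hG j, (hb j).2⟩⟩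
  set Z : ℝ := ((2 * R) ^ n * ((4 * (C * r)) ^ n) ^ m) * ((4 ^ n) ^ (m + 1) * (2 * X) ^ n) with hZ
  have hcell : ∀ k ∈ I, volume (⋃ a ∈ (hfin k).toFinset, N a) ≤ ENNReal.ofReal Z := by
    intro k _
    set D := ∏ j, (2 : ℝ) ^ k j with hD
    have hD0 : 0 < D := Finset.prod_pos fun j _ => by positivity
    have hN : ∀ a ∈ (hfin k).toFinset, volume (N a) ≤
        ENNReal.ofReal ((2 * R) ^ n * ((4 * (C * r)) ^ n / D) ^ m) := by
      intro a ha
      obtain ⟨ha0, ha1, ha2, ha3⟩ := (hfin k).mem_toFinset.1 ha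
      rw [volume_pi_pi]
      calc _ ≤ ∏ j, ENNReal.ofReal (2 * R * (2 * (C * r / ‖embedVec (σ j) a‖)) ^ m) :=
            Finset.prod_le_prod' fun j _ =>
              volume_nearly_parallel_le (embedVec_ne_zero _ ha0) (by positivity)
        _ = ENNReal.ofReal (∏ j, (2 * R * (2 * (C * r / ‖embedVec (σ j) a‖)) ^ m)) :=
            (ENNReal.ofReal_prod_of_nonneg fun j _ => by positivity).symm
        _ ≤ ENNReal.ofReal (∏ j, (2 * R * (4 * (C * r) / 2 ^ k j) ^ m)) := by
            refine ENNReal.ofReal_le_ofReal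
              (Finset.prod_le_prod (fun j _ => by positivity) fun j _ => ?_)
            have h1 := ha3 j
            rw [zpow_sub_one₀ two_ne_zero] at h1
            have h2 : 2 * (C * r / ‖embedVec (σ j) a‖) ≤ 4 * (C * r) / 2 ^ k j := by
              have h3 : 0 < (2 : ℝ) ^ k j := by positivity
              rw [← mul_div_assoc, div_le_div_iff₀ (by linarith) h3]
              have : 0 ≤ C * r := by positivity
              nlinarith
            gcongr
        _ = _ := by
            rw [Finset.prod_mul_distrib, Finset.prod_const, Finset.card_fin, Finset.prod_pow,
              Finset.prod_div_distrib, Finset.prod_const, Finset.card_fin]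
    calc _ ≤ ∑ a ∈ (hfin k).toFinset, volume (N a) := measure_biUnion_finset_le _ _
      _ ≤ (hfin k).toFinset.card • ENNReal.ofReal ((2 * R) ^ n * ((4 * (C * r)) ^ n / D) ^ m) :=
          Finset.sum_le_card_nsmul _ _ _ hN
      _ = ENNReal.ofReal ((dyadicCell (m := m) σ X k).ncard *
            ((2 * R) ^ n * ((4 * (C * r)) ^ n / D) ^ m)) := by
          rw [nsmul_eq_mul, Set.ncard_eq_toFinset_card _ (hfin k),
            ENNReal.ofReal_mul (p := ((hfin k).toFinset.card : ℝ)) (by positivity),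
            ENNReal.ofReal_natCast]
      _ ≤ ENNReal.ofReal ((4 ^ n) ^ (m + 1) * D ^ m * (2 * X) ^ n *
            ((2 * R) ^ n * ((4 * (C * r)) ^ n / D) ^ m)) := by
          refine ENNReal.ofReal_le_ofReal (mul_le_mul_of_nonneg_right
            (dyadicCell_finite_and_ncard_le hn σ hX0 k).2 (by positivity))
      _ = ENNReal.ofReal Z := by
          -- Here D^m from the count cancels D^(-m) from the volumes.
          congr 1
          rw [hZ, div_pow]
          field_simp
  calc _ ≤ ∑ k ∈ I, volume (⋃ a ∈ (hfin k).toFinset, N a) :=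
        (measure_mono hsub).trans (measure_biUnion_finset_le _ _)
    _ ≤ I.card • ENNReal.ofReal Z := Finset.sum_le_card_nsmul _ _ _ hcell
    _ = ENNReal.ofReal (((n + 1) * q + 1) ^ n * Z) := by
        have : I.card = ((n + 1) * q + 1) ^ n := by
          rw [Fintype.card_piFinset, Finset.prod_const, Finset.card_fin, Int.card_Icc]
          congr 1
          zify
          rw [Int.toNat_of_nonneg (by rw [sub_neg_eq_add]; positivity)]
          ring
        rw [nsmul_eq_mul, this, ENNReal.ofReal_mul (q := Z) (by positivity)]
        congr 1
        rw [← ENNReal.ofReal_natCast]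
        push_cast
        rfl
    _ = _ := by
        congr 2
        rw [hZ, hX]
        rw [pow_right_comm _ n m, pow_right_comm _ n (m + 1), ← mul_pow, ← mul_pow, ← mul_pow,
          show (16 : ℝ) ^ (m + 1) = 4 ^ m * 4 ^ m * 16 by
            rw [← mul_pow, show (4 : ℝ) * 4 = 16 by norm_num, pow_succ]]
        congr 1
        ring

end Measure

/-! ### Borel–Cantelli and the lower bound on the first minimum -/

section AlmostEverywhere

variable {K : Type*} [Field K] [NumberField K] {n m : ℕ}

lemma summable_add_one_pow_mul_geometric (k : ℕ) {x : ℝ} (hx0 : 0 < x) (hx1 : x < 1) :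
    Summable fun M : ℕ => ((M : ℝ) + 1) ^ k * x ^ M := by
  have h := (summable_nat_add_iff 1).2 (summable_pow_mul_geometric_of_norm_lt_one (R := ℝ) k
    (r := x) (by rwa [Real.norm_eq_abs, abs_of_pos hx0]))
  refine (h.mul_right x⁻¹).congr fun M => ?_
  rw [Nat.cast_add_one, pow_succ, mul_assoc, mul_assoc, mul_inv_cancel₀ hx0.ne', mul_one]

lemma ae_eventually_notMem_shortSet (hn : Module.finrank ℚ K = n) (σ : Fin n ≃ (K →+* ℝ))
    {R δ : ℝ} (hR : 0 ≤ R) (hδ : 0 < δ) :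
    ∀ᵐ G : Fin n → Fin (m + 1) → ℝ, ∀ᶠ M : ℕ in atTop,
      G ∉ shortSet σ m R (2 ^ M) ((2 : ℝ) ^ (-(M * (1 / (2 * (m + 1)) + δ)) : ℝ)) := by
  have hn0 : 0 < n := hn ▸ Module.finrank_pos
  set C := √((m + 1 : ℕ) * R ^ 2 + 1) with hC
  have hC0 : 0 ≤ C := Real.sqrt_nonneg _
  obtain ⟨c, hc⟩ := pow_unbounded_of_one_lt C one_lt_two
  -- With P = 2^M and r = P^(-1/(2L) - δ), the quantity r^L √P equals ρ^M, so the volumes decay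
  -- geometrically up to a factor polynomial in M.
  set ρ : ℝ := 2 ^ (-((m + 1) * δ)) with hρ
  have hρ0 : 0 < ρ := by positivity
  have hρ1 : ρ < 1 := Real.rpow_lt_one_of_one_lt_of_neg one_lt_two (by
    have : 0 < (m + 1) * δ := by positivity
    linarith)
  have hrP : ∀ M : ℕ, ((2 : ℝ) ^ (-(M * (1 / (2 * (m + 1)) + δ)) : ℝ)) ^ (m + 1) * √(2 ^ M)
      = ρ ^ M := fun M => by
    rw [Real.sqrt_eq_rpow, ← Real.rpow_natCast, ← Real.rpow_natCast, ← Real.rpow_natCast,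
      ← Real.rpow_mul zero_le_two, ← Real.rpow_mul zero_le_two, ← Real.rpow_mul zero_le_two,
      ← Real.rpow_add zero_lt_two]
    congr 1
    push_cast
    field_simp
    ring
  set Q : ℝ := R * 16 ^ (m + 1) * C ^ (m + 1) with hQ
  have hQ0 : 0 ≤ Q := by positivity
  have hbound : ∀ M : ℕ, volume (shortSet σ m R (2 ^ M)
      ((2 : ℝ) ^ (-(M * (1 / (2 * (m + 1)) + δ)) : ℝ))) ≤
      ENNReal.ofReal ((((n + 1) * (c + 1)) * Q) ^ n * (((M : ℝ) + 1) ^ n * (ρ ^ n) ^ M)) := by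
    intro M
    have h2M : (1 : ℝ) ≤ 2 ^ M := one_le_pow₀ one_le_two
    refine (volume_shortSet_le hn σ hR h2M (by positivity) (q := M + c) ?_).trans
      (ENNReal.ofReal_le_ofReal ?_)
    · rw [← hC, pow_add, mul_comm ((2 : ℝ) ^ M)]
      have h1 : (2 : ℝ) ^ (-(M * (1 / (2 * (m + 1)) + δ)) : ℝ) ≤ 1 :=
        Real.rpow_le_one_of_one_le_of_nonpos one_le_two (neg_nonpos.2 (by positivity))
      have h2 : √((2 : ℝ) ^ M) ≤ 2 ^ M := by
        rw [Real.sqrt_le_left (by positivity)]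
        exact le_self_pow₀ h2M two_ne_zero
      calc _ ≤ (2 : ℝ) ^ c * 1 * 2 ^ M := by gcongr
        _ = _ := by ring
    · rw [← hC, ← hQ, hrP, ← mul_pow, pow_right_comm ρ, ← mul_pow, ← mul_pow]
      refine pow_le_pow_left₀ (by positivity) ?_ n
      have h3 : ((n : ℝ) + 1) * ((M + c : ℕ) : ℝ) + 1 ≤ (n + 1) * (c + 1) * (M + 1) := by
        push_cast
        have : (0 : ℝ) ≤ n := n.cast_nonneg
        have : (0 : ℝ) ≤ c * M := by positivity
        nlinarith
      calc _ ≤ ((n + 1) * (c + 1) * (M + 1)) * (Q * ρ ^ M) := by gcongr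
        _ = _ := by ring
  refine ae_eventually_notMem (ne_top_of_le_ne_top ?_ (ENNReal.tsum_le_tsum hbound))
  exact ((summable_add_one_pow_mul_geometric n (by positivity)
    (pow_lt_one₀ hρ0.le hρ1 hn0.ne')).mul_left _).tsum_ofReal_ne_top

/-- For almost all channels, all nonzero vectors have length at least `P ^ (-(1/L + ε))`. -/
lemma ae_eventually_rpow_le_humbertForm (hn : Module.finrank ℚ K = n) (σ : Fin n ≃ (K →+* ℝ)) :
    ∀ᵐ G : Fin n → Fin (m + 1) → ℝ, ∀ ε > 0, ∀ᶠ P : ℝ in atTop,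
      ∀ a : Fin (m + 1) → 𝓞 K, a ≠ 0 →
        P ^ (-(1 / ((m + 1 : ℕ) : ℝ) + ε)) ≤ humbertForm σ (fun l j => G j l) P a := by
  -- Integer radii and slacks 1/(k + 1) leave only countably many null sets to discard.
  have h : ∀ᵐ G : Fin n → Fin (m + 1) → ℝ, ∀ R k : ℕ, ∀ᶠ M : ℕ in atTop,
      G ∉ shortSet σ m R (2 ^ M)
        ((2 : ℝ) ^ (-(M * (1 / (2 * (m + 1)) + 1 / ((k : ℝ) + 1))) : ℝ)) :=
    ae_all_iff.2 fun R => ae_all_iff.2 fun k =>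
      ae_eventually_notMem_shortSet hn σ R.cast_nonneg (by positivity)
  filter_upwards [h] with G hG ε hε
  obtain ⟨R, hR⟩ := exists_nat_ge ‖G‖
  obtain ⟨k, hk⟩ := exists_nat_one_div_lt (show 0 < ε / 4 by positivity)
  obtain ⟨M₀, hM₀⟩ := eventually_atTop.1 (hG R k)
  set δ : ℝ := 1 / ((k : ℝ) + 1) with hδ
  have hδ0 : 0 < δ := by positivity
  set e : ℝ := 1 / ((m + 1 : ℕ) : ℝ) with he
  have he0 : 0 < e := by positivity
  filter_upwards [eventually_ge_atTop ((2 : ℝ) ^ M₀), eventually_ge_atTop 1,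
    (tendsto_rpow_atTop (show 0 < ε / 2 by positivity)).eventually_ge_atTop (2 ^ (e + ε))]
    with P hPM hP1 hPε a ha
  have hP0 : 0 < P := by linarith
  -- The form decreases in P, so the bound at the next power of two, 2^(M+1) ≤ 2P, transfers to P.
  -- Half of ε covers δ; the other half absorbs the factor 2.
  obtain ⟨M, hM1, hM2⟩ := exists_nat_pow_near hP1 one_lt_two
  have hMM : M₀ ≤ M + 1 :=
    ((pow_lt_pow_iff_right₀ (one_lt_two (α := ℝ))).1 (hPM.trans_lt hM2)).le
  have h1 := hM₀ (M + 1) hMM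
  have h2 : ((2 : ℝ) ^ (-((M + 1 : ℕ) * (1 / (2 * (m + 1)) + δ)) : ℝ)) ^ 2
      ≤ humbertForm σ (fun l j => G j l) (2 ^ (M + 1)) a := by
    by_contra! hlt
    exact h1 ⟨fun j => (norm_le_pi_norm G j).trans hR, a, ha, hlt⟩
  refine le_trans ?_ (h2.trans (humbertForm_antitone σ _ hP0.le hM2.le a))
  have h3 : ((2 : ℝ) ^ (-((M + 1 : ℕ) * (1 / (2 * (m + 1)) + δ)) : ℝ)) ^ 2
      = ((2 : ℝ) ^ (M + 1)) ^ (-(e + 2 * δ)) := by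
    rw [← Real.rpow_natCast, ← Real.rpow_natCast, ← Real.rpow_mul zero_le_two,
      ← Real.rpow_mul zero_le_two, he]
    congr 1
    push_cast
    field_simp
  rw [h3]
  have h4 : (2 : ℝ) ^ (M + 1) ≤ 2 * P := by rw [pow_succ]; linarith
  calc P ^ (-(e + ε)) ≤ (2 * P) ^ (-(e + 2 * δ)) := by
        rw [Real.rpow_neg hP0.le, Real.rpow_neg (by positivity)]
        refine inv_anti₀ (by positivity) ?_
        calc (2 * P) ^ (e + 2 * δ) ≤ (2 * P) ^ (e + ε / 2) :=
              Real.rpow_le_rpow_of_exponent_le (by linarith) (by linarith)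
          _ = 2 ^ (e + ε / 2) * P ^ (e + ε / 2) := Real.mul_rpow zero_le_two hP0.le
          _ ≤ 2 ^ (e + ε) * P ^ (e + ε / 2) := by
              gcongr
              · exact one_le_two
              · linarith
          _ ≤ P ^ (ε / 2) * P ^ (e + ε / 2) := by gcongr
          _ = P ^ (e + ε) := by rw [← Real.rpow_add hP0]; congr 1; ring
    _ ≤ _ := Real.rpow_le_rpow_of_nonpos (by positivity) h4 (by linarith)

instance isAddHaarMeasure_volume_pi_pi :
    (volume : Measure (Fin m → Fin n → ℝ)).IsAddHaarMeasure :=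
  Measure.pi.isAddHaarMeasure fun _ : Fin m => (volume : Measure (Fin n → ℝ))

/-- Exchanging the order of the two indices of a double family preserves null sets. -/
lemma ae_swap {p : (Fin n → Fin m → ℝ) → Prop} (h : ∀ᵐ G, p G) :
    ∀ᵐ H : Fin m → Fin n → ℝ, p (fun j l => H l j) := by
  let e : (Fin m → Fin n → ℝ) ≃ₗ[ℝ] (Fin n → Fin m → ℝ) :=
    { toFun := fun H j l => H l j
      invFun := fun G l j => G j l
      map_add' := fun _ _ => rfl
      map_smul' := fun _ _ => rfl
      left_inv := fun _ => rfl
      right_inv := fun _ => rfl }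
  let e' := e.toContinuousLinearEquiv
  have : (Measure.map e' volume).IsAddHaarMeasure :=
    e'.isAddHaarMeasure_map volume
  have hac : Measure.map e' volume ≪ (volume : Measure (Fin n → Fin m → ℝ)) :=
    Measure.absolutelyContinuous_isAddHaarMeasure _ _
  exact ae_of_ae_map e'.continuous.measurable.aemeasurable (hac.ae_le h)

lemma ae_forall_ne_zero (hm : 0 < m) : ∀ᵐ G : Fin n → Fin m → ℝ, ∀ j, G j ≠ 0 := by
  rw [ae_all_iff]
  intro j
  have : NeZero m := ⟨hm.ne'⟩
  have h : ∀ᵐ g : Fin m → ℝ, g ≠ 0 := by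
    rw [ae_iff]
    simp
  exact (Measure.tendsto_eval_ae_ae (μ := fun _ : Fin n => (volume : Measure (Fin m → ℝ)))
    (i := j)).eventually h

end AlmostEverywhere

/-! ### Minkowski's theorem and boxes adapted to a hyperplane -/

section Minkowski

variable {K : Type*} [Field K] [NumberField K] {n m : ℕ}

/-- Dedekind's independence of characters: a relation between the rows holds on a ℚ-basis, hence on
all of K. -/
lemma isUnit_embeddings_matrix (σ : Fin n ≃ (K →+* ℝ)) (b : Module.Basis (Fin n) ℚ K) :
    IsUnit (Matrix.of fun j k => σ j (b k) : Matrix (Fin n) (Fin n) ℝ) := by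
  rw [← Matrix.linearIndependent_rows_iff_isUnit, Fintype.linearIndependent_iff]
  intro g hg
  have hLI : LinearIndependent ℝ fun j => (⇑(σ j : K →* ℝ) : K → ℝ) :=
    (linearIndependent_monoidHom K ℝ).comp (fun j => (σ j : K →* ℝ)) fun i j hij =>
      σ.injective (RingHom.ext fun x => DFunLike.congr_fun hij x)
  refine Fintype.linearIndependent_iff.1 hLI g ?_
  have hzero : (∑ j, g j • ((σ j).toRatAlgHom.toLinearMap : K →ₗ[ℚ] ℝ)) = 0 := by
    refine b.ext fun k => ?_
    have := congrFun hg k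
    simpa [Finset.sum_apply, Matrix.row] using this
  funext x
  have := LinearMap.congr_fun hzero x
  simpa [Finset.sum_apply] using this

/-- Minkowski's first theorem for the module `𝓞_K ^ L`. -/
lemma exists_ne_zero_embedVec_mem (hn : Module.finrank ℚ K = n) (σ : Fin n ≃ (K →+* ℝ)) (L : ℕ) :
    ∃ C : ℝ, ∀ S : Set (Fin n → Fin L → ℝ), (∀ x ∈ S, -x ∈ S) → Convex ℝ S →
      ENNReal.ofReal C < volume S →
      ∃ a : Fin L → 𝓞 K, a ≠ 0 ∧ (fun j => embedVec (σ j) a) ∈ S := by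
  have hcard : Fintype.card (Module.Free.ChooseBasisIndex ℤ (𝓞 K)) = n := by
    rw [← hn, Module.finrank_eq_card_basis (integralBasis K)]
  let ι := Fintype.equivFinOfCardEq hcard
  let ω : Fin n → 𝓞 K := fun k => RingOfIntegers.basis K (ι.symm k)
  have hU := isUnit_embeddings_matrix σ ((integralBasis K).reindex ι)
  have hcols := Matrix.linearIndependent_cols_iff_isUnit.2 hU
  have hω : ∀ k, ((integralBasis K).reindex ι) k = (ω k : K) := fun k => by
    simp [ω, integralBasis_apply]
  rcases Nat.eq_zero_or_pos n with hn0 | hn0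
  · exact absurd (hn ▸ Module.finrank_pos (R := ℚ) (M := K)) (by omega)
  have : Nonempty (Fin n) := ⟨⟨0, hn0⟩⟩
  let v : Module.Basis (Fin n) ℝ (Fin n → ℝ) :=
    basisOfLinearIndependentOfCardEqFinrank hcols (by simp)
  have hv : ∀ k j, v k j = σ j (ω k : K) := fun k j => by
    have : ⇑v = _ := coe_basisOfLinearIndependentOfCardEqFinrank hcols (by simp)
    rw [this, Matrix.col, Matrix.transpose_apply, Matrix.of_apply, hω]
  let e : (Fin L → Fin n → ℝ) ≃ₗ[ℝ] (Fin n → Fin L → ℝ) :=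
    { toFun := fun H j l => H l j
      invFun := fun G l j => G j l
      map_add' := fun _ _ => rfl
      map_smul' := fun _ _ => rfl
      left_inv := fun _ => rfl
      right_inv := fun _ => rfl }
  let b := (Pi.basis fun _ : Fin L => v).map e
  have hb : ∀ p, b p = fun j => embedVec (σ j) (Pi.single p.1 (ω p.2)) := by
    rintro ⟨l, k⟩
    funext j l'
    simp only [b, Module.Basis.map_apply, Pi.basis_apply, e, LinearEquiv.coe_mk, LinearMap.coe_mk,
      AddHom.coe_mk, embedVec]
    by_cases hl : l' = l
    · subst hl
      simp [hv]
    · simp [hl]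
  have hlat : ∀ x ∈ Submodule.span ℤ (Set.range b),
      ∃ a : Fin L → 𝓞 K, x = fun j => embedVec (σ j) a := by
    intro x hx
    induction hx using Submodule.span_induction with
    | mem x hx =>
      obtain ⟨p, rfl⟩ := hx
      exact ⟨_, hb p⟩
    | zero =>
      refine ⟨0, ?_⟩
      funext j l
      simp [embedVec]
    | add x y _ _ hx hy =>
      obtain ⟨a, rfl⟩ := hx
      obtain ⟨a', rfl⟩ := hy
      refine ⟨a + a', ?_⟩
      funext j l
      simp [embedVec]
    | smul z x _ hx =>
      obtain ⟨a, rfl⟩ := hx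
      refine ⟨z • a, ?_⟩
      funext j l
      simp [embedVec]
  have : Countable (Submodule.span ℤ (Set.range b)).toAddSubgroup := by
    change Countable (Submodule.span ℤ (Set.range b))
    infer_instance
  have hfd := ZSpan.isAddFundamentalDomain b (volume : Measure (Fin n → Fin L → ℝ))
  have hfin : volume (ZSpan.fundamentalDomain b) * 2 ^ Module.finrank ℝ (Fin n → Fin L → ℝ) ≠ ⊤ :=
    ENNReal.mul_ne_top (ZSpan.fundamentalDomain_isBounded b).measure_lt_top.ne (by finiteness)
  -- The Minkowski constant 2^(nL) · covolume, which depends only on the lattice and not on the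
  -- channel or P.
  refine ⟨(volume (ZSpan.fundamentalDomain b) *
    2 ^ Module.finrank ℝ (Fin n → Fin L → ℝ)).toReal, fun S hS hconv hvol => ?_⟩
  rw [ENNReal.ofReal_toReal hfin] at hvol
  obtain ⟨x, hx0, hxS⟩ := exists_ne_zero_mem_lattice_of_measure_mul_two_pow_lt_measure
    (L := (Submodule.span ℤ (Set.range b)).toAddSubgroup) hfd hS hconv hvol
  obtain ⟨a, ha⟩ := hlat x x.2
  refine ⟨a, ?_, ha ▸ hxS⟩
  rintro rfl
  refine hx0 (Subtype.ext ?_)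
  rw [ha]
  funext j l
  simp [embedVec]

lemma volume_pi_parallelepiped {L : ℕ} (D : Fin n → Matrix (Fin L) (Fin L) ℝ)
    (hD : ∀ j, (D j).det ≠ 0) {τ : Fin L → ℝ} (hτ : ∀ i, 0 ≤ τ i) :
    volume (Set.univ.pi fun j => {y : Fin L → ℝ | ∀ i, |(D j *ᵥ y) i| < τ i})
      = ENNReal.ofReal (∏ j, (|(D j).det|⁻¹ * ∏ i, (2 * τ i))) := by
  rw [volume_pi_pi, ENNReal.ofReal_prod_of_nonneg fun j _ =>
    mul_nonneg (by positivity) (Finset.prod_nonneg fun i _ => by linarith [hτ i])]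
  refine Finset.prod_congr rfl fun j _ => ?_
  have h1 : {y : Fin L → ℝ | ∀ i, |(D j *ᵥ y) i| < τ i}
      = Matrix.toLin' (D j) ⁻¹' Set.univ.pi fun i => Set.Ioo (-τ i) (τ i) := by
    ext y
    simp [abs_lt]
  rw [h1, Measure.addHaar_preimage_linearMap _ (by rw [LinearMap.det_toLin']; exact hD j),
    LinearMap.det_toLin', Real.volume_pi_Ioo, abs_inv, ENNReal.ofReal_mul (by positivity),
    ENNReal.ofReal_prod_of_nonneg fun i _ => by linarith [hτ i]]
  congr 1
  refine Finset.prod_congr rfl fun i _ => ?_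
  congr 1
  ring

lemma sum_sq_lt {L : ℕ} (hn : 0 < n) (hL : 0 < L) {z : Fin n → Fin L → ℝ} {s t : ℝ}
    (hs : s ^ 2 * (n * L) = 1) (hz : ∀ j i, |z j i| < s * t) :
    ∑ j, z j ⬝ᵥ z j < t ^ 2 := by
  have hn' : (Finset.univ : Finset (Fin n)).Nonempty := ⟨⟨0, hn⟩, Finset.mem_univ _⟩
  have hL' : (Finset.univ : Finset (Fin L)).Nonempty := ⟨⟨0, hL⟩, Finset.mem_univ _⟩
  calc ∑ j, z j ⬝ᵥ z j < ∑ _j : Fin n, ∑ _i : Fin L, (s * t) ^ 2 := by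
        refine Finset.sum_lt_sum_of_nonempty hn' fun j _ =>
          Finset.sum_lt_sum_of_nonempty hL' fun i _ => ?_
        rw [← sq]
        exact sq_lt_sq' (abs_lt.1 (hz j i)).1 (abs_lt.1 (hz j i)).2
    _ = t ^ 2 := by
        simp only [Finset.sum_const, Finset.card_fin, nsmul_eq_mul]
        linear_combination t ^ 2 * hs

/-- If the vectors of length at most `r` do not span, and all nonzero vectors have length at
least `μ`, then `r * μ ^ (L - 1)` is small. -/
lemma exists_forall_mul_prod_le (hn : Module.finrank ℚ K = n) (σ : Fin n ≃ (K →+* ℝ)) (m : ℕ) :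
    ∃ C : ℝ, ∀ (H : Fin (m + 1) → Fin n → ℝ) (P μ r : ℝ), 0 ≤ P → 0 < μ → μ ≤ r →
      (∀ a : Fin (m + 1) → 𝓞 K, a ≠ 0 → μ ^ 2 ≤ humbertForm σ H P a) →
      Module.finrank K (ballSpan σ H P r) < m + 1 →
      (r * μ ^ m) ^ n * ∏ j, √(P * (blockVector H j ⬝ᵥ blockVector H j) + 1) ≤ C := by
  have hn0 : 0 < n := hn ▸ Module.finrank_pos
  obtain ⟨C, hC⟩ := exists_ne_zero_embedVec_mem hn σ (m + 1)
  -- There are nL coordinates, so bounding each by s t bounds the length by t.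
  set s : ℝ := 1 / √(n * (m + 1 : ℕ)) with hs
  have hs0 : 0 < s := by positivity
  have hs2 : s ^ 2 * (n * (m + 1 : ℕ)) = 1 := by
    rw [hs, div_pow, Real.sq_sqrt (by positivity)]
    field_simp
  -- C may be negative, whereas a strict inequality between `ENNReal.ofReal` values needs a positive
  -- right-hand side.
  refine ⟨max C 0 / ((2 * s) ^ (m + 1)) ^ n, fun H P μ r hP hμ hμr hshort hrank => ?_⟩
  have hr : 0 < r := hμ.trans_le hμr
  have hVtop : ballSpan σ H P r < ⊤ := by
    refine lt_top_iff_ne_top.2 fun h => ?_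
    rw [h, finrank_top, Module.finrank_fin_fun] at hrank
    exact lt_irrefl _ hrank
  -- The hyperplane is defined over K, so its coefficients can be conjugated by every σ_j, giving
  -- one adapted factor per block.
  obtain ⟨f, hf0, hf⟩ := Submodule.exists_le_ker_of_lt_top _ hVtop
  let c : Fin (m + 1) → K := fun l => f (Pi.single l 1)
  have hfc : ∀ x, f x = ∑ l, c l * x l := fun x => by
    have h1 : ∀ l : Fin (m + 1),
        (fun j => if l = j then (1 : K) else 0) = Pi.single l 1 := fun l => by
      ext j
      simp only [Pi.single_apply, eq_comm]
    rw [f.pi_apply_eq_sum_univ x]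
    simp [c, mul_comm, h1]
  have hc : ∀ j, (fun l => σ j (c l)) ≠ 0 := fun j h => hf0 <| by
    refine LinearMap.ext fun x => ?_
    rw [hfc]
    have : ∀ l, c l = 0 := fun l => by simpa using congrFun h l
    simp [this]
  choose D hDdet hDform hDlast using fun j => exists_adapted_factor hP (blockVector H j) _ (hc j)
  have hpos : ∀ j, 0 < P * (blockVector H j ⬝ᵥ blockVector H j) + 1 := fun j => by
    linarith [one_le_mul_dotProduct_add_one hP (blockVector H j)]
  have hD0 : ∀ j, (D j).det ≠ 0 := fun j h => by
    have := hDdet j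
    rw [h] at this
    simp at this
  have hDabs : ∀ j, |(D j).det|⁻¹ = √(P * (blockVector H j ⬝ᵥ blockVector H j) + 1) := fun j => by
    rw [eq_comm, Real.sqrt_eq_iff_mul_self_eq (hpos j).le (by positivity), ← mul_inv, ← sq, sq_abs]
    exact eq_inv_of_mul_eq_one_right (hDdet j)
  let τ : Fin (m + 1) → ℝ := fun i => s * if i = Fin.last m then r else μ
  have hτ : ∀ i, 0 ≤ τ i := fun i => by
    simp only [τ]
    split_ifs <;> positivity
  have hτprod : ∏ i, (2 * τ i) = (2 * s) ^ (m + 1) * (r * μ ^ m) := by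
    rw [Fin.prod_univ_castSucc]
    simp [τ, Fin.castSucc_ne_last]
    ring
  set S : Set (Fin n → Fin (m + 1) → ℝ) :=
    Set.univ.pi fun j => {y : Fin (m + 1) → ℝ | ∀ i, |(D j *ᵥ y) i| < τ i} with hS
  have hvol := volume_pi_parallelepiped D hD0 hτ
  rw [hτprod, Finset.prod_mul_distrib, Finset.prod_const, Finset.card_fin] at hvol
  simp only [hDabs] at hvol
  by_contra! hlt
  rw [div_lt_iff₀ (by positivity)] at hlt
  have hSsymm : ∀ x ∈ S, -x ∈ S := fun x hx j _ i => by
    have := hx j trivial i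
    rwa [Pi.neg_apply, Matrix.mulVec_neg, Pi.neg_apply, abs_neg]
  have hSconv : Convex ℝ S := by
    refine convex_pi fun j _ => ?_
    have : {y : Fin (m + 1) → ℝ | ∀ i, |(D j *ᵥ y) i| < τ i}
        = Matrix.toLin' (D j) ⁻¹' Set.univ.pi fun i => Set.Ioo (-τ i) (τ i) := by
      ext y
      simp [abs_lt]
    rw [this]
    exact (convex_pi fun i _ => convex_Ioo _ _).linear_preimage _
  obtain ⟨a, ha0, haS⟩ := hC S hSsymm hSconv (by
    rw [hvol]
    refine (ENNReal.ofReal_lt_ofReal_iff' ).2 ?_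
    have h1 : max C 0 < (∏ j, √(P * (blockVector H j ⬝ᵥ blockVector H j) + 1)) *
        ((2 * s) ^ (m + 1) * (r * μ ^ m)) ^ n := by
      rw [mul_pow]
      linarith
    exact ⟨(le_max_left _ _).trans_lt h1, (le_max_right _ _).trans_lt h1⟩)
  have hz : ∀ j i, |(D j *ᵥ embedVec (σ j) a) i| < τ i := fun j i => haS j trivial i
  have hF : humbertForm σ H P a
      = ∑ j, (D j *ᵥ embedVec (σ j) a) ⬝ᵥ (D j *ᵥ embedVec (σ j) a) :=
    Finset.sum_congr rfl fun j _ => hDform j _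
  have hle : √(humbertForm σ H P a) ≤ r := by
    rw [Real.sqrt_le_left hr.le, hF]
    refine (sum_sq_lt hn0 m.succ_pos hs2 fun j i => (hz j i).trans_le ?_).le
    refine mul_le_mul_of_nonneg_left ?_ hs0.le
    split_ifs
    · exact le_rfl
    · exact hμr
  have hfa : ∑ l, c l * (a l : K) = 0 := by
    rw [← hfc fun l => (a l : K)]
    exact hf (Submodule.subset_span ⟨a, rfl, hle⟩)
  have hlast : ∀ j, (D j *ᵥ embedVec (σ j) a) (Fin.last m) = 0 := fun j => by
    refine hDlast j _ ?_
    have := congrArg (σ j) hfa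
    simpa [dotProduct, embedVec] using this
  -- The only long side of the box is the last one, and that coordinate vanishes in every block, so
  -- a is shorter than μ.
  refine absurd (hshort a ha0) (not_le.2 ?_)
  rw [hF]
  refine sum_sq_lt hn0 m.succ_pos hs2 fun j i => ?_
  by_cases hi : i = Fin.last m
  · rw [hi, hlast, abs_zero]
    positivity
  · simpa [τ, hi] using hz j i

end Minkowski

/-! ### Exponents of the minima and the limits -/

section DegreesOfFreedom

variable {K : Type*} [Field K] [NumberField K] {n m : ℕ}

/-- The last successive minimum is at most a constant times `P ^ (-1/2) * μ ^ (1 - L)`, where `μ`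
is a lower bound for the first. -/
lemma exists_forall_last_le (hn : Module.finrank ℚ K = n) (σ : Fin n ≃ (K →+* ℝ))
    (H : Fin (m + 1) → Fin n → ℝ) (hH : ∀ j, blockVector H j ≠ 0) :
    ∃ C : ℝ, 0 < C ∧ ∀ (P μ : ℝ), 0 < P → 0 < μ →
      (∀ a : Fin (m + 1) → 𝓞 K, a ≠ 0 → μ ^ 2 ≤ humbertForm σ H P a) →
      ∀ a : Fin (m + 1) → Fin (m + 1) → 𝓞 K, AttainsSuccMin σ H P a →
        √(humbertForm σ H P (a (Fin.last m))) * μ ^ m * √P ≤ C := by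
  have hn0 : 0 < n := hn ▸ Module.finrank_pos
  obtain ⟨C, hC⟩ := exists_forall_mul_prod_le hn σ m
  set N := ∏ j, √(blockVector H j ⬝ᵥ blockVector H j) with hN
  have hhpos : ∀ j, 0 < blockVector H j ⬝ᵥ blockVector H j := fun j => by
    have := norm_pos_iff.2 (hH j)
    exact lt_of_lt_of_le (by positivity) (norm_sq_le_dotProduct _)
  have hN0 : 0 < N := Finset.prod_pos fun j _ => Real.sqrt_pos.2 (hhpos j)
  set B := max (C / N) 1 with hB
  have hB1 : 1 ≤ B := le_max_right _ _
  refine ⟨2 ^ (m + 1) * B, by positivity, fun P μ hP hμ hshort a ha => ?_⟩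
  set T := √(humbertForm σ H P (a (Fin.last m))) with hT
  have ha0 : a (Fin.last m) ≠ 0 := fun h => ha.1.ne_zero (Fin.last m) (by
    funext l
    simp [h])
  have hμT : μ ≤ T := Real.le_sqrt_of_sq_le (hshort _ ha0)
  have hT0 : 0 < T := hμ.trans_le hμT
  have hrank : Module.finrank K (ballSpan σ H P (T / 2)) < m + 1 := by
    refine finrank_ballSpan_lt σ H m.succ_pos ?_
    have := ha.2 (Fin.last m)
    rw [← hT, Fin.val_last] at this
    rw [← this]
    linarith
  -- T is halved to get strictly below the last minimum; μ is halved with it to keep μ/2 ≤ T/2.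
  have key := hC H P (μ / 2) (T / 2) hP.le (by positivity) (by linarith)
    (fun b hb => le_trans (by nlinarith) (hshort b hb)) hrank
  have hprod : √P ^ n * N ≤ ∏ j, √(P * (blockVector H j ⬝ᵥ blockVector H j) + 1) := by
    calc √P ^ n * N = ∏ j, √(P * (blockVector H j ⬝ᵥ blockVector H j)) := by
          simp only [Real.sqrt_mul hP.le, Finset.prod_mul_distrib, Finset.prod_const,
            Finset.card_fin, hN]
      _ ≤ _ := Finset.prod_le_prod (fun _ _ => Real.sqrt_nonneg _) fun j _ =>
          Real.sqrt_le_sqrt (by linarith)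
  have h1 : (T / 2 * (μ / 2) ^ m * √P) ^ n ≤ B ^ n := by
    calc (T / 2 * (μ / 2) ^ m * √P) ^ n ≤ C / N := by
          rw [le_div_iff₀ hN0, mul_pow, mul_assoc]
          exact (mul_le_mul_of_nonneg_left hprod (by positivity)).trans key
      _ ≤ B := le_max_left _ _
      _ ≤ B ^ n := le_self_pow₀ hB1 hn0.ne'
  have h2 := (pow_le_pow_iff_left₀ (by positivity) (by positivity) hn0.ne').1 h1
  calc T * μ ^ m * √P = 2 ^ (m + 1) * (T / 2 * (μ / 2) ^ m * √P) := by
        rw [div_pow]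
        field_simp
        ring
    _ ≤ _ := by gcongr

/-- For almost all channels, all successive minima are `P ^ (-1 / (2L) + o(1))`. -/
lemma ae_eventually_humbertForm_bounds (hn : Module.finrank ℚ K = n) (σ : Fin n ≃ (K →+* ℝ)) :
    ∀ᵐ H : Fin (m + 1) → Fin n → ℝ, ∀ a : ℝ → Fin (m + 1) → Fin (m + 1) → 𝓞 K,
      (∀ P : ℝ, 0 < P → AttainsSuccMin σ H P (a P)) → ∀ i, ∀ ε > 0, ∀ᶠ P : ℝ in atTop,
        P ^ (-(1 / ((m + 1 : ℕ) : ℝ) + ε)) ≤ humbertForm σ H P (a P i) ∧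
        humbertForm σ H P (a P i) ≤ P ^ (-(1 / ((m + 1 : ℕ) : ℝ) - ε)) := by
  filter_upwards [ae_swap (ae_eventually_rpow_le_humbertForm (m := m) hn σ),
    ae_swap (ae_forall_ne_zero (n := n) m.succ_pos)] with H hlow hne a ha i ε hε
  have hlow' : ∀ ε > 0, ∀ᶠ P : ℝ in atTop, ∀ a : Fin (m + 1) → 𝓞 K, a ≠ 0 →
      P ^ (-(1 / ((m + 1 : ℕ) : ℝ) + ε)) ≤ humbertForm σ H P a := hlow
  obtain ⟨C, hC0, hC⟩ := exists_forall_last_le hn σ H hne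
  set e : ℝ := 1 / ((m + 1 : ℕ) : ℝ) with he
  have hem : e * (m + 1) = 1 := by
    rw [he]
    push_cast
    field_simp
  set δ : ℝ := ε / (m + 1) with hδ
  have hδ0 : 0 < δ := by positivity
  have hδm : δ * (m + 1) = ε := by rw [hδ]; field_simp
  filter_upwards [eventually_gt_atTop 0, hlow' ε hε, hlow' δ hδ0,
    (tendsto_rpow_atTop hδ0).eventually_ge_atTop (C ^ 2)] with P hP h1 h2 h3
  refine ⟨h1 _ fun h => (ha P hP).1.ne_zero i (by funext l; simp [h]), ?_⟩
  refine ((ha P hP).humbertForm_le_last hP.le i).trans ?_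
  -- Squaring gives F ≤ C² P^(m(e + δ) - 1), and P^δ absorbs C². Since (m + 1)e = 1 and (m + 1)δ =
  -- ε, the exponent becomes -e + ε.
  have h4 := hC P (P ^ (-(e + δ) / 2)) hP (by positivity) (fun b hb => by
    rw [← Real.rpow_natCast, ← Real.rpow_mul hP.le]
    convert h2 b hb using 2
    push_cast
    ring) (a P) (ha P hP)
  have h5 := pow_le_pow_left₀ (by positivity) h4 2
  have hF := humbertForm_nonneg σ H hP.le (a P (Fin.last m))
  have h6 : (P ^ (-(e + δ) / 2)) ^ m = P ^ (-(e + δ) / 2 * m) := by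
    rw [← Real.rpow_natCast, ← Real.rpow_mul hP.le]
  rw [mul_pow, mul_pow, Real.sq_sqrt hF, Real.sq_sqrt hP.le, h6, ← Real.rpow_natCast,
    ← Real.rpow_mul hP.le, mul_assoc, ← Real.rpow_add_one hP.ne'] at h5
  have h7 := h5.trans h3
  rw [← le_div_iff₀ (by positivity), ← Real.rpow_sub hP] at h7
  refine h7.trans (le_of_eq ?_)
  congr 1
  push_cast
  linear_combination hem + hδm

/-- Logarithms turn the power bounds into a squeeze: log P / log(1 + P) → 1 and the log n term
vanishes in the limit. For ε < e the positive part is inactive once P > 1, since then F < 1 ≤ n. -/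
lemma hasDoF_of_bounds (hn : 0 < n) {F : ℝ → ℝ} {e : ℝ} (he : 0 < e)
    (hF : ∀ ε > 0, ∀ᶠ P : ℝ in atTop, P ^ (-(e + ε)) ≤ F P ∧ F P ≤ P ^ (-(e - ε))) :
    HasDoF (fun P => (n : ℝ) / 2 * logPlus (n / F P)) (n * e) := by
  have hlog0 : ∀ c : ℝ, Tendsto (fun P : ℝ => c / Real.log (1 + P)) atTop (𝓝 0) := fun c =>
    (Real.tendsto_log_atTop.comp (tendsto_atTop_add_const_left _ 1 tendsto_id)).const_div_atTop c
  have hlog1 : Tendsto (fun P : ℝ => Real.log P / Real.log (1 + P)) atTop (𝓝 1) := by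
    refine tendsto_of_tendsto_of_tendsto_of_le_of_le'
      (by simpa using (hlog0 (Real.log 2)).const_sub 1) tendsto_const_nhds ?_ ?_
    · filter_upwards [eventually_ge_atTop 1] with P hP
      have h6 : 0 < Real.log (1 + P) := Real.log_pos (by linarith)
      rw [le_div_iff₀ h6, sub_mul, one_mul, div_mul_cancel₀ _ h6.ne', sub_le_iff_le_add,
        ← Real.log_mul (by linarith) two_ne_zero]
      exact Real.log_le_log (by linarith) (by linarith)
    · filter_upwards [eventually_ge_atTop 1] with P hP
      rw [div_le_one (Real.log_pos (by linarith))]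
      exact Real.log_le_log (by linarith) (by linarith)
  have hmain : Tendsto (fun P => logPlus (n / F P) / Real.logb 2 (1 + P)) atTop (𝓝 e) := by
    have hlower : ∀ ε > 0, ε < e → ∀ᶠ P : ℝ in atTop,
        (e - ε) * (Real.log P / Real.log (1 + P)) + Real.log n / Real.log (1 + P)
          ≤ logPlus (n / F P) / Real.logb 2 (1 + P) ∧
        logPlus (n / F P) / Real.logb 2 (1 + P) ≤
          (e + ε) * (Real.log P / Real.log (1 + P)) + Real.log n / Real.log (1 + P) := by
      intro ε hε hεe
      filter_upwards [hF ε hε, eventually_gt_atTop 1] with P ⟨h1, h2⟩ hP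
      have hP0 : 0 < P := by linarith
      have hF0 : 0 < F P := lt_of_lt_of_le (by positivity) h1
      have hn' : (1 : ℝ) ≤ n := by exact_mod_cast hn
      have h3 := Real.log_le_log (by positivity) h1
      have h4 := Real.log_le_log hF0 h2
      rw [Real.log_rpow hP0] at h3 h4
      have h5 : 0 < Real.log P := Real.log_pos hP
      have h6 : 0 < Real.log (1 + P) := Real.log_pos (by linarith)
      have h7 : 0 < Real.log 2 := Real.log_pos one_lt_two
      have h8 : 0 ≤ Real.log n := Real.log_nonneg hn'
      have h9 : Real.log (n / F P) = Real.log n - Real.log (F P) :=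
        Real.log_div (by positivity) hF0.ne'
      have h10 : 0 < (e - ε) * Real.log P := mul_pos (by linarith) h5
      have h11 : logPlus (n / F P) = (Real.log n - Real.log (F P)) / Real.log 2 := by
        rw [logPlus, Real.logb, h9, max_eq_left]
        refine div_nonneg ?_ h7.le
        linarith
      rw [h11, Real.logb, div_div_div_cancel_right₀ h7.ne', ← mul_div_assoc, ← mul_div_assoc,
        ← add_div, ← add_div]
      constructor
      · gcongr
        linarith
      · gcongr
        linarith
    have hlim : ∀ x : ℝ, Tendsto (fun P : ℝ => x * (Real.log P / Real.log (1 + P))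
        + Real.log n / Real.log (1 + P)) atTop (𝓝 x) := fun x => by
      simpa using (hlog1.const_mul x).add (hlog0 (Real.log n))
    rw [Metric.tendsto_nhds]
    intro η hη
    set ε := min (η / 2) (e / 2) with hε
    have hε0 : 0 < ε := by positivity
    have hε1 : ε ≤ η / 2 := min_le_left _ _
    have hε2 : ε ≤ e / 2 := min_le_right _ _
    filter_upwards [hlower ε hε0 (by linarith),
      (hlim (e - ε)).eventually_const_lt (show e - η < e - ε by linarith),
      (hlim (e + ε)).eventually_lt_const (show e + ε < e + η by linarith)] with P ⟨h1, h2⟩ h3 h4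
    rw [Real.dist_eq, abs_lt]
    constructor <;> linarith
  refine (hmain.const_mul (n : ℝ)).congr fun P => ?_
  beta_reduce
  rw [div_mul_eq_mul_div, div_mul_eq_mul_div, one_mul, div_div_div_cancel_right₀ two_ne_zero,
    mul_div_assoc]

end DegreesOfFreedom

end RingCF

end

/-! ### The degrees of freedom theorem -/

theorem mainTheorem1 {K : Type*} [Field K] [NumberField K] [NumberField.IsTotallyReal K]
    (n L : ℕ) (hn : Module.finrank ℚ K = n) (hL : 0 < L) (σ : Fin n ≃ (K →+* ℝ)) :
    (∀ (H : Fin L → Fin n → ℝ) (P : ℝ), 0 < P →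
      ∃ a : Fin L → Fin L → 𝓞 K, RingCF.AttainsSuccMin σ H P a) ∧
    ∀ᵐ H : Fin L → Fin n → ℝ ∂(volume : Measure (Fin L → Fin n → ℝ)),
      ∀ a : ℝ → Fin L → Fin L → 𝓞 K, (∀ P : ℝ, 0 < P → RingCF.AttainsSuccMin σ H P (a P)) →
        ∃ d : Fin L → ℝ,
          (∀ i : Fin L, RingCF.HasDoF (fun P => RingCF.eqRate σ H P (a P i)) (d i)) ∧
          (∀ i : Fin L, d i = (n : ℝ) / (L : ℝ)) ∧
          ∑ i : Fin L, d i = (n : ℝ) ∧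
          RingCF.HasDoF (fun P => ∑ i : Fin L, RingCF.eqRate σ H P (a P i)) (n : ℝ) := by
  refine ⟨fun H P hP => RingCF.exists_attainsSuccMin hn σ H hP.le, ?_⟩
  obtain ⟨m, rfl⟩ := Nat.exists_eq_succ_of_ne_zero hL.ne'
  have hn0 : 0 < n := hn ▸ Module.finrank_pos
  filter_upwards [RingCF.ae_eventually_humbertForm_bounds (m := m) hn σ] with H hH a ha
  have hdof : ∀ i : Fin (m + 1), RingCF.HasDoF (fun P => RingCF.eqRate σ H P (a P i))
      ((n : ℝ) / ((m + 1 : ℕ) : ℝ)) := fun i => by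
    have := RingCF.hasDoF_of_bounds hn0 (F := fun P => RingCF.humbertForm σ H P (a P i))
      (e := 1 / ((m + 1 : ℕ) : ℝ)) (by positivity) (hH a ha i)
    rwa [mul_one_div] at this
  have hsum : ∑ _i : Fin (m + 1), (n : ℝ) / ((m + 1 : ℕ) : ℝ) = n := by
    rw [Finset.sum_const, Finset.card_fin, nsmul_eq_mul, mul_div_cancel₀]
    positivity
  refine ⟨fun _ => (n : ℝ) / ((m + 1 : ℕ) : ℝ), hdof, fun _ => rfl, hsum, ?_⟩
  have h := tendsto_finsetSum Finset.univ fun i _ => hdof i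
  rw [hsum] at h
  refine h.congr fun P => ?_
  rw [Finset.sum_div]
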